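/- **Theorem.** Let $k\in\mathbb N$, let $\Gamma\in\mathbb R^{k\times k}$ be symmetric positive definite with smallest eigenvalue bounded below by some $\mu_{\min}\in(0,1]$, and let $\Xi$ be a set of design parameters. Let $C_0\ge 1$, $\beta\ge 1$, let $0<p\le\min\{\tfrac23,\tfrac1\beta\}$, $p\ne\tfrac1\beta$, and let $\boldsymbol b=(b_j)_{j\ge1}\in\ell^p(\mathbb N)$ be a sequence of nonnegative reals. For $s\ge1$ put $\Theta_s:=[-\tfrac12,\tfrac12]^s$, and let $G_s:\Theta_s\times\Xi\to\mathbb R^k$, $s\ge 1$, be forward models that are smooth in $\boldsymbol\theta\in\Theta_s$ and satisfy $$\|\partial^{\boldsymbol\nu}_{\boldsymbol\theta}G_s(\boldsymbol\theta,\boldsymbol\xi)\|\le C_0(|\boldsymbol\nu|!)^\beta\,\boldsymbol b^{\boldsymbol\nu}\qquad\text{for all }\boldsymbol\theta\in\Theta_s,\ \boldsymbol\nu\in\mathbb N_0^s,\ \boldsymbol\xi\in\Xi,\ s\ge 1 .$$ Put $f(\boldsymbol\theta,\boldsymbol y):=\det(2\pi\Gamma)^{-1/2}\exp\bigl(-\tfrac12(\boldsymbol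 y-G_s(\boldsymbol\theta,\boldsymbol\xi))^{\rm T}\Gamma^{-1}(\boldsymbol y-G_s(\boldsymbol\theta,\boldsymbol\xi))\bigr)$ and $g(x):=x\log x$, and for $K>0$ let $$\mathcal I_K:=\int_{[-K,K]^k}g\Bigl(\int_{\Theta_s}f(\boldsymbol\theta,\boldsymbol y)\,{\rm d}\boldsymbol\theta\Bigr){\rm d}\boldsymbol y .$$ For $d,n\in\mathbb N$ and positive weights $\boldsymbol\gamma=(\gamma_{\mathfrak u})_{\mathfrak u\subseteq\{1:d\}}$, a vector $\boldsymbol z\in\{0,\dots,n-1\}^d$ is called a *CBC vector* if its components are obtained one after the other, $z_j$ being, for $j=1,\dots,d$, a minimizer over all $z\in\{0,\dots,n-1\}$ with $\gcd(z,n)=1$ of the squared shift-averaged worst-case error in the weighted unanchored Sobolev space, $$e_j^2(z_1,\dots,z_{j-1},z):=\sum_{\varnothing\ne\mathfrak u\subseteq\{1:j\}}\gamma_{\mathfrak u}\,\frac1n\sum_{i=1}^n\prod_{m\in\mathfrak u}B_2\Bigl(\Bigl\{\frac{i z_m}{n}\Bigr\}\Bigr)\quad(\text{with } z_j=z),\qquad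 B_2(x)=x^2-x+\tfrac16 ,$$ where $\{\cdot\}$ is the (componentwise) fractional part. For a level $\ell\ge0$ let $n=2^\ell$, let $\boldsymbol z_1$ and $\boldsymbol z_2$ be CBC vectors in dimensions $k$ and $s$ for weights $\boldsymbol\gamma_1$ and $\boldsymbol\gamma_2$, and let $\boldsymbol\Delta_1\sim\mathcal U([0,1]^k)$, $\boldsymbol\Delta_2\sim\mathcal U([0,1]^s)$ be independent random shifts. With the outer points scaled to $[-K,K]^k$, the full tensor product approximation of $\mathcal I_K$ is $$\mathcal Q_\ell:=\frac{(2K)^k}{n}\sum_{i=1}^{n}g\Bigl(\frac1n\sum_{j=1}^{n}f(\boldsymbol\theta_j,\boldsymbol y_i)\Bigr),\qquad \boldsymbol y_i=2K\Bigl\{\frac{i\boldsymbol z_1}{n}+\boldsymbol\Delta_1\Bigr\}-K\mathbf 1,\quad \boldsymbol\theta_j=\Bigl\{\frac{j\boldsymbol z_2}{n}+\boldsymbol\Delta_2\Bigr\}-\tfrac12\mathbf 1 .$$ Then for all $s\ge1$, $K>0$, positive weights $\boldsymbol\gamma_1,\boldsymbol\gamma_2$ and every $\delta>0$ there is a constant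 $C>0$ such that, for all $\boldsymbol\xi\in\Xi$, all $\ell\ge0$ and all such CBC vectors $\boldsymbol z_1,\boldsymbol z_2$, the error is square-integrable with respect to the shifts and $$\text{R.M.S. error}:=\sqrt{\mathbb E_{\boldsymbol\Delta_1,\boldsymbol\Delta_2}\bigl|\mathcal I_K-\mathcal Q_\ell\bigr|^2}\le C\,(2^\ell)^{-\frac12+\delta}.$$ -/

import Mathlib

open scoped ContDiff Matrix

noncomputable section

namespace NestedQMC

/-- The parameter domain `Θ_s = [-1/2, 1/2]^s`; the prior density is `1` on it. -/
def paramBox (s : ℕ) : Set (Fin s → ℝ) :=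
  Set.Icc (fun _ => -(1 / 2 : ℝ)) (fun _ => (1 / 2 : ℝ))

/-- The truncated data domain `[-K, K]^k`. -/
def dataBox (k : ℕ) (K : ℝ) : Set (Fin k → ℝ) :=
  Set.Icc (fun _ => -K) (fun _ => K)

/-- The mixed partial derivative `∂^ν F (x)` relative to the set `S`, for a multi-index `ν`:
the derivative of order `|ν|`, evaluated at the list of coordinate directions that contains
the `j`-th one `ν j` times. -/
def partialDerivWithin {s : ℕ} {E : Type*} [NormedAddCommGroup E] [NormedSpace ℝ E]
    (ν : Fin s → ℕ) (F : (Fin s → ℝ) → E) (S : Set (Fin s → ℝ)) (x : Fin s → ℝ) : E :=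
  iteratedFDerivWithin ℝ (∑ j, ν j) F S x
    (fun i => Pi.single (finSigmaFinEquiv.symm i).1 (1 : ℝ))

/-- The Gevrey regularity of a sequence of forward models `G_s : Θ_s × Ξ → ℝ^k`, `s ≥ 1`:
`G_s(·, ξ)` is smooth on `Θ_s` and `‖∂^ν G_s(θ, ξ)‖ ≤ C (|ν|!)^β b^ν`
for all `θ ∈ Θ_s`, all multi-indices `ν` and all `ξ`.
The sequence `b` is indexed from `0`. -/
def GevreyRegular {k : ℕ} {Ξ : Type*} (C β : ℝ) (b : ℕ → ℝ)
    (G : (s : ℕ) → (Fin s → ℝ) → Ξ → EuclideanSpace ℝ (Fin k)) : Prop :=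
  ∀ s : ℕ, 1 ≤ s → ∀ ξ : Ξ,
    ContDiffOn ℝ ∞ (fun θ => G s θ ξ) (paramBox s) ∧
    ∀ θ ∈ paramBox s, ∀ ν : Fin s → ℕ,
      ‖partialDerivWithin ν (fun θ' => G s θ' ξ) (paramBox s) θ‖ ≤
        C * (((∑ j, ν j).factorial : ℝ) ^ β) * ∏ j : Fin s, b j ^ ν j

/-- `‖v‖_{Γ⁻¹} = (vᵀ Γ⁻¹ v)^{1/2}`. -/
def weightedNorm {k : ℕ} (Γ : Matrix (Fin k) (Fin k) ℝ) (v : Fin k → ℝ) : ℝ :=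
  Real.sqrt (v ⬝ᵥ (Γ⁻¹ *ᵥ v))

/-- `C_{k,Γ} = det(2πΓ)^{-1/2}`. -/
def normConst {k : ℕ} (Γ : Matrix (Fin k) (Fin k) ℝ) : ℝ :=
  1 / Real.sqrt ((2 * Real.pi) • Γ).det

/-- The data likelihood `C_{k,Γ} exp(-½ ‖y - m‖²_{Γ⁻¹})`, where `m` is the model output. -/
def likelihood {k : ℕ} (Γ : Matrix (Fin k) (Fin k) ℝ) (m : EuclideanSpace ℝ (Fin k))
    (y : Fin k → ℝ) : ℝ :=
  normConst Γ * Real.exp (-(1 / 2) * weightedNorm Γ (fun i => y i - m i) ^ 2)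

/-- The truncated double integral `I_K`, for the forward model `F = G_s(·, ξ)`. -/
def truncatedIntegral {s k : ℕ} (Γ : Matrix (Fin k) (Fin k) ℝ)
    (F : (Fin s → ℝ) → EuclideanSpace ℝ (Fin k)) (K : ℝ) : ℝ :=
  ∫ y in dataBox k K,
    Real.log (∫ θ in paramBox s, likelihood Γ (F θ) y) *
      ∫ θ in paramBox s, likelihood Γ (F θ) y

/-- The rank-1 lattice point `t_i = {i z / n}` (componentwise fractional part). -/
def latticePoint {d : ℕ} (n : ℕ) (z : Fin d → ℕ) (i : ℕ) : Fin d → ℝ :=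
  fun j => Int.fract ((i : ℝ) * (z j : ℝ) / (n : ℝ))

/-- The shifted lattice point `{t_i + Δ}` in `[0, 1)^d`. -/
def shiftedPoint {d : ℕ} (n : ℕ) (z : Fin d → ℕ) (Δ : Fin d → ℝ) (i : ℕ) : Fin d → ℝ :=
  fun j => Int.fract (latticePoint n z i j + Δ j)

/-- The inner shifted lattice rule over `Θ_s = [-1/2, 1/2]^s`. -/
def innerRule {s : ℕ} (n : ℕ) (z : Fin s → ℕ) (Δ : Fin s → ℝ) (f : (Fin s → ℝ) → ℝ) : ℝ :=
  (1 / (n : ℝ)) * ∑ i ∈ Finset.Icc 1 n, f (fun j => shiftedPoint n z Δ i j - 1 / 2)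

/-- The outer shifted lattice rule, with its points scaled to `[-K, K]^k`. -/
def outerRule {k : ℕ} (n : ℕ) (z : Fin k → ℕ) (K : ℝ) (Δ : Fin k → ℝ)
    (h : (Fin k → ℝ) → ℝ) : ℝ :=
  (2 * K) ^ k *
    ((1 / (n : ℝ)) * ∑ i ∈ Finset.Icc 1 n, h (fun j => 2 * K * shiftedPoint n z Δ i j - K))

/-- The full tensor product approximation of `I_K`: the outer rule with `n₁` points, applied to
`g` of the inner rule with `n₂` points, where `g(x) = x log x`. -/
def fullTensorApprox {s k : ℕ} (Γ : Matrix (Fin k) (Fin k) ℝ)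
    (F : (Fin s → ℝ) → EuclideanSpace ℝ (Fin k)) (K : ℝ)
    (n₁ n₂ : ℕ) (z₁ : Fin k → ℕ) (z₂ : Fin s → ℕ) (Δ₁ : Fin k → ℝ) (Δ₂ : Fin s → ℝ) : ℝ :=
  outerRule n₁ z₁ K Δ₁ fun y =>
    innerRule n₂ z₂ Δ₂ (fun θ => likelihood Γ (F θ) y) *
      Real.log (innerRule n₂ z₂ Δ₂ (fun θ => likelihood Γ (F θ) y))

/-- The joint law of two independent random shifts, uniform in `[0,1]^k` and in `[0,1]^s`. -/
def shiftLaw (k s : ℕ) : MeasureTheory.Measure ((Fin k → ℝ) × (Fin s → ℝ)) :=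
  (MeasureTheory.volume.restrict (Set.Icc 0 1)).prod (MeasureTheory.volume.restrict (Set.Icc 0 1))

/-- The error of the full tensor product approximation of `I_K` as a function of the shifts. -/
def fullTensorError {s k : ℕ} (Γ : Matrix (Fin k) (Fin k) ℝ)
    (F : (Fin s → ℝ) → EuclideanSpace ℝ (Fin k)) (K : ℝ)
    (n₁ n₂ : ℕ) (z₁ : Fin k → ℕ) (z₂ : Fin s → ℕ)
    (Δ : (Fin k → ℝ) × (Fin s → ℝ)) : ℝ :=
  truncatedIntegral Γ F K - fullTensorApprox Γ F K n₁ n₂ z₁ z₂ Δ.1 Δ.2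

/-- The root-mean-square of a function of the two random shifts. -/
def rms {k s : ℕ} (e : (Fin k → ℝ) × (Fin s → ℝ) → ℝ) : ℝ :=
  Real.sqrt (∫ Δ, |e Δ| ^ 2 ∂shiftLaw k s)

/-- The Bernoulli polynomial `B₂(x) = x² - x + 1/6`. -/
def bernoulliTwo (x : ℝ) : ℝ := x ^ 2 - x + 1 / 6

/-- The squared shift-averaged worst-case error, in the weighted unanchored Sobolev space of
functions with square-integrable mixed first derivatives and weights `γ`, of the lattice rule
with generating vector `(z_j)_{j ≤ d}` (the components up to `d` only). -/
def shiftAveragedErrorSq {s : ℕ} (n : ℕ) (γ : Finset (Fin s) → ℝ) (z : Fin s → ℕ)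
    (d : Fin s) : ℝ :=
  ∑ u ∈ (Finset.Iic d).powerset with u.Nonempty,
    γ u * ((1 / (n : ℝ)) *
      ∑ i ∈ Finset.Icc 1 n, ∏ j ∈ u, bernoulliTwo (latticePoint n z i j))

/-- `z` is a possible output of the component-by-component algorithm with `n` points and
weights `γ`: each component `z_d` in turn is an element of `{0, …, n-1}` coprime to `n`
that minimizes the shift-averaged worst-case error in the first `d` coordinates, the earlier
components being kept. (For `n = 1` this leaves `z = 0`.) -/
def IsCBCVector {s : ℕ} (n : ℕ) (γ : Finset (Fin s) → ℝ) (z : Fin s → ℕ) : Prop :=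
  ∀ d : Fin s, z d < n ∧ (z d).Coprime n ∧
    ∀ w : ℕ, w < n → w.Coprime n →
      shiftAveragedErrorSq n γ z d ≤ shiftAveragedErrorSq n γ (Function.update z d w) d

theorem shiftAveragedErrorSq_congr {s : ℕ} (n : ℕ) (γ : Finset (Fin s) → ℝ)
    {z z' : Fin s → ℕ} {d : Fin s} (h : ∀ j ≤ d, z j = z' j) :
    shiftAveragedErrorSq n γ z d = shiftAveragedErrorSq n γ z' d := by
  unfold shiftAveragedErrorSq
  refine Finset.sum_congr rfl fun u hu => ?_
  have hu' := Finset.mem_powerset.1 (Finset.mem_filter.1 hu).1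
  congr 2
  refine Finset.sum_congr rfl fun i _ => Finset.prod_congr rfl fun j hj => ?_
  simp only [latticePoint, h j (Finset.mem_Iic.1 (hu' hj))]

/-- The component-by-component algorithm always has an output. -/
theorem exists_isCBCVector {s : ℕ} {n : ℕ} (hn : 1 ≤ n) (γ : Finset (Fin s) → ℝ) :
    ∃ z : Fin s → ℕ, IsCBCVector n γ z := by
  suffices H : ∀ m : ℕ, ∃ z : Fin s → ℕ, ∀ d : Fin s, (d : ℕ) < m → z d < n ∧ (z d).Coprime n ∧
      ∀ w : ℕ, w < n → w.Coprime n →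
        shiftAveragedErrorSq n γ z d ≤ shiftAveragedErrorSq n γ (Function.update z d w) d by
    obtain ⟨z, hz⟩ := H s
    exact ⟨z, fun d => hz d d.2⟩
  intro m
  induction m with
  | zero => exact ⟨fun _ => 0, fun d hd => absurd hd (Nat.not_lt_zero _)⟩
  | succ m ih =>
    obtain ⟨z, hz⟩ := ih
    by_cases hm : m < s
    · let d₀ : Fin s := ⟨m, hm⟩
      have hne : ((Finset.range n).filter fun w => w.Coprime n).Nonempty := by
        rcases Nat.lt_or_ge 1 n with h | h
        · exact ⟨1, by simp [h]⟩
        · obtain rfl : n = 1 := le_antisymm h hn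
          exact ⟨0, by simp⟩
      obtain ⟨w₀, hw₀, hmin⟩ := Finset.exists_min_image _
        (fun w => shiftAveragedErrorSq n γ (Function.update z d₀ w) d₀) hne
      simp only [Finset.mem_filter, Finset.mem_range] at hw₀ hmin
      refine ⟨Function.update z d₀ w₀, fun d hd => ?_⟩
      rcases Nat.lt_succ_iff_lt_or_eq.1 hd with h | h
      · have hne' : d ≠ d₀ := fun e => by simp [e, d₀] at h
        obtain ⟨h1, h2, h3⟩ := hz d h
        have hlt : ∀ j ≤ d, j ≠ d₀ := fun j hj e => by
          subst e
          exact absurd (Fin.le_def.1 hj) (by simpa [d₀] using h)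
        refine ⟨by simpa [hne'] using h1, by simpa [hne'] using h2, fun w hw hc => ?_⟩
        have e1 : shiftAveragedErrorSq n γ (Function.update z d₀ w₀) d =
            shiftAveragedErrorSq n γ z d :=
          shiftAveragedErrorSq_congr n γ fun j hj => by simp [hlt j hj]
        have e2 : shiftAveragedErrorSq n γ (Function.update (Function.update z d₀ w₀) d w) d =
            shiftAveragedErrorSq n γ (Function.update z d w) d :=
          shiftAveragedErrorSq_congr n γ fun j hj => by simp [Function.update_apply, hlt j hj]
        rw [e1, e2]
        exact h3 w hw hc
      · obtain rfl : d = d₀ := Fin.ext h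
        refine ⟨by simpa using hw₀.1, by simpa using hw₀.2, fun w hw hc => ?_⟩
        simpa using hmin w ⟨hw, hc⟩
    · exact ⟨z, fun d _ => hz d (by have := d.2; omega)⟩

end NestedQMC

end

/-! The constant may depend on `s`, `K` and the weights, so it suffices to bound the mean square
error by `A / n`, `n = 2 ^ ℓ`, with `A` independent of the design, of `ℓ` and of the generating
vectors. This gives the rate `1/2`, and `δ` is to spare.

Let `J(Δ₂)` be the exact outer integral of `g` applied to the inner rule. The error is (double
integral − `J`) + (`J` − tensor rule). For bounded data and models all likelihoods lie in some `[c,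
C]` with `c > 0`, where `g` is Lipschitz; hence the first bracket is controlled by the mean square
error of the inner rule, averaged over the data. The second is, for each fixed `Δ₂`, an outer
lattice rule error (`tensorError_sq_le`). Both therefore follow from one estimate for a shifted
lattice rule applied to an integrand whose derivatives are bounded by `M`
(`exists_integral_latticeRule_error_sq_le`).

For that estimate, write `φ(x) = ∫ φ + ∫ k(x,t) φ'(t) dt` with `k(x,t) = t - 1_{x<t}` in each
coordinate. The error is then at most `M` times the sum over nonempty coordinate sets `u` of the
`L¹` norms of lattice averages of product kernels (`abs_sum_sub_mean_le`). Averaging the squares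
over the shift turns pairs of kernels into `B₂` (`integral_shift_kernel`), and the double sum over
lattice points collapses to the unweighted `u`-term of the CBC criterion (`integral_kernelMean_sq`).
A CBC minimum is at most the average over the odd candidates, which is `O(1/n)`
(`sum_weighted_latticeMean_le`); all terms being nonnegative, each one is `O(1/n)`
(`latticeMean_le_of_isCBCVector`).

It remains to have `M` uniform. By symmetry of iterated derivatives the Gevrey bounds on mixed
partials become operator norm bounds, uniform in the design (`GevreyRegular.uniformlySmooth`).
Composition and averaging preserve such bounds, so `g` of the inner rule has derivatives bounded
independently of the number of points, the shift and the generating vector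
(`uniformlySmooth_mul_log_average_likelihood`). -/

noncomputable section

namespace NestedQMC

open MeasureTheory Set

/-! ### Weighted Bernoulli sums over lattices with `2 ^ ℓ` points -/

/-- The contribution of the coordinate set `u` to the shift-averaged worst-case error. -/
def latticeMean {d : ℕ} (n : ℕ) (z : Fin d → ℕ) (u : Finset (Fin d)) : ℝ :=
  (1 / (n : ℝ)) * ∑ i ∈ Finset.Icc 1 n, ∏ j ∈ u, bernoulliTwo (latticePoint n z i j)

/-- The sum of `B₂({i w / 2 ^ ℓ})` over a full period of `w`. -/
def bernoulliSum (ℓ i : ℕ) : ℝ :=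
  ∑ w ∈ Finset.range (2 ^ ℓ), bernoulliTwo (Int.fract ((i : ℝ) * w / (2 ^ ℓ : ℕ)))

theorem sum_range_bernoulliTwo_div (m N : ℕ) (hm : 0 < m) :
    ∑ w ∈ Finset.range N, bernoulliTwo ((w : ℝ) / m) =
      (N * (N - 1) * (2 * N - 1) / 6) / (m : ℝ) ^ 2 - (N * (N - 1) / 2) / m + N / 6 := by
  have hm' : (m : ℝ) ≠ 0 := by positivity
  induction N with
  | zero => simp
  | succ N ih =>
    rw [Finset.sum_range_succ, ih, bernoulliTwo]
    push_cast
    field_simp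
    ring

theorem sum_bernoulliTwo_div_self (m : ℕ) (hm : 0 < m) :
    ∑ w ∈ Finset.range m, bernoulliTwo ((w : ℝ) / m) = 1 / (6 * m) := by
  have hm' : (m : ℝ) ≠ 0 := by positivity
  rw [sum_range_bernoulliTwo_div m m hm]
  field_simp
  ring

/-- Multiplication by an odd `i` permutes the residues mod `2 ^ ℓ`, which reduces the sum to the
case `i = 1`. -/
theorem bernoulliSum_of_odd {ℓ i : ℕ} (hi : Odd i) : bernoulliSum ℓ i = 1 / (6 * 2 ^ ℓ) := by
  have hpos : 0 < 2 ^ ℓ := by positivity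
  have hfr : ∀ w : ℕ, Int.fract ((i : ℝ) * w / (2 ^ ℓ : ℕ)) =
      ((i * w % 2 ^ ℓ : ℕ) : ℝ) / (2 ^ ℓ : ℕ) := fun w => by
    rw [← Nat.cast_mul]; exact Int.fract_div_natCast_eq_div_natCast_mod
  have hmaps : ∀ w ∈ Finset.range (2 ^ ℓ), i * w % 2 ^ ℓ ∈ Finset.range (2 ^ ℓ) := fun w _ =>
    Finset.mem_range.2 (Nat.mod_lt _ hpos)
  have hinj : Set.InjOn (fun w => i * w % 2 ^ ℓ) (Finset.range (2 ^ ℓ) : Set ℕ) := by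
    intro a ha b hb hab
    have hcop : Nat.gcd (2 ^ ℓ) i = 1 := (Nat.Coprime.pow_left ℓ (Nat.coprime_two_left.2 hi))
    have h : a ≡ b [MOD 2 ^ ℓ] := Nat.ModEq.cancel_left_of_coprime hcop hab
    simp only [Finset.coe_range, Set.mem_Iio] at ha hb
    rwa [Nat.ModEq, Nat.mod_eq_of_lt ha, Nat.mod_eq_of_lt hb] at h
  have := Finset.sum_nbij (f := fun w : ℕ => bernoulliTwo (Int.fract ((i : ℝ) * w / (2 ^ ℓ : ℕ))))
    (g := fun w : ℕ => bernoulliTwo ((w : ℝ) / (2 ^ ℓ : ℕ))) (fun w : ℕ => i * w % 2 ^ ℓ) hmaps hinj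
    (Finset.surjOn_of_injOn_of_card_le _ hmaps hinj le_rfl) (fun w _ => by simp only [hfr])
  rw [bernoulliSum, this, sum_bernoulliTwo_div_self _ hpos]
  push_cast
  rfl

theorem bernoulliTwo_fract_add_natCast (x : ℝ) (a : ℕ) :
    bernoulliTwo (Int.fract (x + a)) = bernoulliTwo (Int.fract x) := by
  rw [Int.fract_add_natCast]

/-- Cancelling the factor 2 lowers the level by one, and the range of `w` then covers two periods.
With the odd case this determines all the sums recursively. -/
theorem bernoulliSum_two_mul (ℓ i : ℕ) :
    bernoulliSum (ℓ + 1) (2 * i) = 2 * bernoulliSum ℓ i := by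
  have h : ∀ w : ℕ, ((2 * i : ℕ) : ℝ) * w / (2 ^ (ℓ + 1) : ℕ) = (i : ℝ) * w / (2 ^ ℓ : ℕ) := by
    intro w; push_cast; rw [pow_succ]; field_simp
  have h' : ∀ w : ℕ, (i : ℝ) * (2 ^ ℓ + w : ℕ) / (2 ^ ℓ : ℕ) = (i : ℝ) * w / (2 ^ ℓ : ℕ) + i := by
    intro w; push_cast; field_simp; ring
  simp only [bernoulliSum, h]
  rw [pow_succ, mul_two, Finset.sum_range_add, two_mul]
  simp only [h', bernoulliTwo_fract_add_natCast]

theorem bernoulliSum_nonneg (ℓ i : ℕ) : 0 ≤ bernoulliSum ℓ i := by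
  induction ℓ generalizing i with
  | zero => simp [bernoulliSum, bernoulliTwo]
  | succ ℓ ih =>
    rcases Nat.even_or_odd' i with ⟨c, rfl | rfl⟩
    · rw [bernoulliSum_two_mul]; have := ih c; positivity
    · rw [bernoulliSum_of_odd ⟨c, rfl⟩]; positivity

theorem sum_range_two_mul (f : ℕ → ℝ) (m : ℕ) :
    ∑ i ∈ Finset.range (2 * m), f i =
      ∑ i ∈ Finset.range m, f (2 * i) + ∑ i ∈ Finset.range m, f (2 * i + 1) := by
  induction m with
  | zero => simp
  | succ m ih =>
    rw [show 2 * (m + 1) = 2 * m + 1 + 1 by ring, Finset.sum_range_succ, Finset.sum_range_succ, ih,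
      Finset.sum_range_succ, Finset.sum_range_succ]
    ring

/-- Splitting `i` by parity gives the recursion `T (ℓ + 1) = 2 * T ℓ + 1 / 12` with `T 0 = 1 / 6`.
-/
theorem sum_bernoulliSum (ℓ : ℕ) :
    ∑ i ∈ Finset.range (2 ^ ℓ), bernoulliSum ℓ i = 2 ^ ℓ / 4 - 1 / 12 := by
  induction ℓ with
  | zero => norm_num [bernoulliSum, bernoulliTwo]
  | succ ℓ ih =>
    rw [pow_succ' 2 ℓ, sum_range_two_mul]
    simp only [bernoulliSum_two_mul, bernoulliSum_of_odd (Nat.odd_iff.2 (Nat.mul_add_mod 2 _ 1)),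
      ← Finset.mul_sum, ih, Finset.sum_const, Finset.card_range, nsmul_eq_mul]
    push_cast
    field_simp
    ring

theorem bernoulliSum_add_period (ℓ i : ℕ) : bernoulliSum ℓ (2 ^ ℓ + i) = bernoulliSum ℓ i := by
  refine Finset.sum_congr rfl fun w _ => ?_
  have : ((2 ^ ℓ + i : ℕ) : ℝ) * w / (2 ^ ℓ : ℕ) = (i : ℝ) * w / (2 ^ ℓ : ℕ) + w := by
    push_cast; field_simp; ring
  rw [this, bernoulliTwo_fract_add_natCast]

/-- The sum of `B₂({i w / 2 ^ (ℓ + 1)})` over the odd residues `w`. -/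
theorem sum_odd_bernoulliTwo (ℓ i : ℕ) :
    ∑ w ∈ Finset.range (2 ^ ℓ),
        bernoulliTwo (Int.fract ((i : ℝ) * (2 * w + 1 : ℕ) / (2 ^ (ℓ + 1) : ℕ))) =
      bernoulliSum (ℓ + 1) i - bernoulliSum ℓ i := by
  have h : ∀ w : ℕ, (i : ℝ) * (2 * w : ℕ) / (2 ^ (ℓ + 1) : ℕ) = (i : ℝ) * w / (2 ^ ℓ : ℕ) := by
    intro w; push_cast; rw [pow_succ]; field_simp
  rw [bernoulliSum, bernoulliSum, pow_succ' 2 ℓ, sum_range_two_mul, ← pow_succ']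
  simp only [h]
  ring

theorem sum_Icc_eq_sum_range {f : ℕ → ℝ} {n : ℕ} (h : f n = f 0) :
    ∑ i ∈ Finset.Icc 1 n, f i = ∑ i ∈ Finset.range n, f i := by
  have h1 : ∑ i ∈ Finset.range (n + 1), f i = f 0 + ∑ i ∈ Finset.Icc 1 n, f i := by
    rw [Finset.range_eq_Ico, Finset.sum_eq_sum_Ico_succ_bot (by omega)]
    rfl
  rw [Finset.sum_range_succ, h] at h1
  linarith

/-- The sum over odd `w` is a difference of two nonnegative full-period sums, so its absolute value
is at most their sum, whose total over `i` is known exactly. -/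
theorem sum_abs_odd_bernoulliTwo_le (ℓ : ℕ) :
    ∑ i ∈ Finset.Icc 1 (2 ^ (ℓ + 1) : ℕ), |∑ w ∈ Finset.range (2 ^ ℓ),
        bernoulliTwo (Int.fract ((i : ℝ) * (2 * w + 1 : ℕ) / (2 ^ (ℓ + 1) : ℕ)))| ≤ 2 ^ ℓ := by
  have hper : bernoulliSum (ℓ + 1) (2 ^ (ℓ + 1)) + bernoulliSum ℓ (2 ^ (ℓ + 1)) =
      bernoulliSum (ℓ + 1) 0 + bernoulliSum ℓ 0 := by
    have h1 := bernoulliSum_add_period (ℓ + 1) 0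
    have h2 := bernoulliSum_add_period ℓ (2 ^ ℓ)
    have h3 := bernoulliSum_add_period ℓ 0
    rw [add_zero] at h1 h3
    rw [← two_mul, ← pow_succ', h3] at h2
    rw [h1, h2]
  calc _ ≤ ∑ i ∈ Finset.Icc 1 (2 ^ (ℓ + 1) : ℕ), (bernoulliSum (ℓ + 1) i + bernoulliSum ℓ i) := by
        refine Finset.sum_le_sum fun i _ => ?_
        rw [sum_odd_bernoulliTwo]
        have h1 := bernoulliSum_nonneg (ℓ + 1) i
        have h2 := bernoulliSum_nonneg ℓ i
        exact abs_le.2 ⟨by linarith, by linarith⟩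
    _ = ∑ i ∈ Finset.range (2 ^ (ℓ + 1)), (bernoulliSum (ℓ + 1) i + bernoulliSum ℓ i) :=
        sum_Icc_eq_sum_range hper
    _ ≤ 2 ^ ℓ := by
        -- The range of length `2 ^ (ℓ + 1)` covers two periods of `bernoulliSum ℓ`; the total is `2
        -- ^ ℓ - 1 / 4`.
        have h := Finset.sum_range_add (bernoulliSum ℓ) (2 ^ ℓ) (2 ^ ℓ)
        simp only [bernoulliSum_add_period, ← mul_two (2 ^ ℓ : ℕ), ← pow_succ 2 ℓ] at h
        rw [Finset.sum_add_distrib, sum_bernoulliSum, h, sum_bernoulliSum]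
        ring_nf
        linarith

theorem abs_bernoulliTwo_fract_le (x : ℝ) : |bernoulliTwo (Int.fract x)| ≤ 1 := by
  have h0 := Int.fract_nonneg x
  have h1 := (Int.fract_lt_one x).le
  rw [bernoulliTwo, abs_le]
  constructor <;> nlinarith

theorem abs_prod_bernoulliTwo_le {d : ℕ} (n : ℕ) (z : Fin d → ℕ) (i : ℕ) (u : Finset (Fin d)) :
    |∏ j ∈ u, bernoulliTwo (latticePoint n z i j)| ≤ 1 := by
  rw [Finset.abs_prod]
  exact Finset.prod_le_one (fun _ _ => abs_nonneg _) fun j _ => abs_bernoulliTwo_fract_le _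

theorem latticeMean_le_one {d : ℕ} {n : ℕ} (hn : 0 < n) (z : Fin d → ℕ) (u : Finset (Fin d)) :
    latticeMean n z u ≤ 1 := by
  have h : ∑ i ∈ Finset.Icc 1 n, ∏ j ∈ u, bernoulliTwo (latticePoint n z i j) ≤
      ∑ i ∈ Finset.Icc 1 n, (1 : ℝ) :=
    Finset.sum_le_sum fun i _ => (le_abs_self _).trans (abs_prod_bernoulliTwo_le n z i u)
  have hn' : (0 : ℝ) < n := by exact_mod_cast hn
  rw [latticeMean, one_div, inv_mul_le_iff₀ hn']
  simpa using h

theorem latticeMean_update_of_notMem {d : ℕ} (n : ℕ) (z : Fin d → ℕ) {u : Finset (Fin d)}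
    {m : Fin d} (hm : m ∉ u) (w : ℕ) :
    latticeMean n (Function.update z m w) u = latticeMean n z u := by
  unfold latticeMean
  congr 1
  refine Finset.sum_congr rfl fun i _ => Finset.prod_congr rfl fun j hj => ?_
  have : j ≠ m := fun e => hm (e ▸ hj)
  simp [latticePoint, this]

/-- The factors of the other coordinates have modulus at most 1, so only the sum over odd `w` in
coordinate `m` matters, whatever those coordinates are. For the mean over the `2 ^ ℓ` candidates
this means at most `1 / 2 ^ (ℓ + 1)`. -/
theorem sum_latticeMean_update_le {d : ℕ} (ℓ : ℕ) (z : Fin d → ℕ) {u : Finset (Fin d)}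
    {m : Fin d} (hm : m ∈ u) :
    ∑ w ∈ Finset.range (2 ^ ℓ), latticeMean (2 ^ (ℓ + 1)) (Function.update z m (2 * w + 1)) u ≤
      1 / 2 := by
  have h : ∀ w, latticeMean (2 ^ (ℓ + 1)) (Function.update z m (2 * w + 1)) u =
      (1 / ((2 ^ (ℓ + 1) : ℕ) : ℝ)) * ∑ i ∈ Finset.Icc 1 (2 ^ (ℓ + 1)),
        (∏ j ∈ u.erase m, bernoulliTwo (latticePoint (2 ^ (ℓ + 1)) z i j)) *
        bernoulliTwo (Int.fract ((i : ℝ) * (2 * w + 1 : ℕ) / (2 ^ (ℓ + 1) : ℕ))) := by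
    intro w
    unfold latticeMean
    congr 1
    refine Finset.sum_congr rfl fun i _ => ?_
    rw [← Finset.prod_erase_mul _ _ hm]
    congr 1
    · refine Finset.prod_congr rfl fun j hj => ?_
      simp [latticePoint, Finset.ne_of_mem_erase hj]
    · simp [latticePoint]
  simp only [h]
  rw [← Finset.mul_sum, Finset.sum_comm]
  simp only [← Finset.mul_sum]
  have h2 : ∑ i ∈ Finset.Icc 1 (2 ^ (ℓ + 1)),
        (∏ j ∈ u.erase m, bernoulliTwo (latticePoint (2 ^ (ℓ + 1)) z i j)) *
        ∑ w ∈ Finset.range (2 ^ ℓ),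
          bernoulliTwo (Int.fract ((i : ℝ) * (2 * w + 1 : ℕ) / (2 ^ (ℓ + 1) : ℕ))) ≤ 2 ^ ℓ := by
    refine (Finset.sum_le_sum fun i _ => ?_).trans (sum_abs_odd_bernoulliTwo_le ℓ)
    refine (le_abs_self _).trans ?_
    rw [abs_mul]
    exact mul_le_of_le_one_left (abs_nonneg _) (abs_prod_bernoulliTwo_le _ _ _ _)
  rw [one_div, inv_mul_le_iff₀ (by positivity)]
  refine h2.trans (le_of_eq ?_)
  push_cast
  ring

/-! ### The component-by-component minimization -/

theorem shiftAveragedErrorSq_eq {d : ℕ} (n : ℕ) (γ : Finset (Fin d) → ℝ) (z : Fin d → ℕ)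
    (m : Fin d) : shiftAveragedErrorSq n γ z m =
      ∑ u ∈ (Finset.Iic m).powerset with u.Nonempty, γ u * latticeMean n z u := rfl

/-- The minimum over admissible components is at most the average over them, and for `n = 2 ^ (ℓ +
1)` the admissible components are the odd residues. -/
theorem sum_weighted_latticeMean_le {d : ℕ} {γ : Finset (Fin d) → ℝ} (hγ : ∀ u, 0 < γ u)
    {ℓ : ℕ} {z : Fin d → ℕ} (hz : IsCBCVector (2 ^ (ℓ + 1)) γ z) (m : Fin d) :
    ∑ u ∈ ((Finset.Iic m).powerset.filter Finset.Nonempty) with m ∈ u,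
        γ u * latticeMean (2 ^ (ℓ + 1)) z u ≤ (∑ u, γ u) / 2 ^ (ℓ + 1) := by
  set n := 2 ^ (ℓ + 1) with hn
  set A := (Finset.Iic m).powerset.filter Finset.Nonempty with hA
  have hmin : ∀ w ∈ Finset.range (2 ^ ℓ), ∑ u ∈ A with m ∈ u, γ u * latticeMean n z u ≤
      ∑ u ∈ A with m ∈ u, γ u * latticeMean n (Function.update z m (2 * w + 1)) u := by
    intro w hw
    have hw' : 2 * w + 1 < n := by
      have := Finset.mem_range.1 hw
      rw [hn, pow_succ]; omega
    have hcop : (2 * w + 1).Coprime n :=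
      (Nat.Coprime.pow_left (ℓ + 1) (Nat.coprime_two_left.2 ⟨w, rfl⟩)).symm
    have h := (hz m).2.2 _ hw' hcop
    rw [shiftAveragedErrorSq_eq, shiftAveragedErrorSq_eq, ← hA,
      ← Finset.sum_filter_add_sum_filter_not A (fun u => m ∈ u),
      ← Finset.sum_filter_add_sum_filter_not A (fun u => m ∈ u)] at h
    -- Sets that avoid `m` do not see the new component and cancel from the minimality inequality.
    have e : ∑ u ∈ A with m ∉ u, γ u * latticeMean n (Function.update z m (2 * w + 1)) u =
        ∑ u ∈ A with m ∉ u, γ u * latticeMean n z u :=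
      Finset.sum_congr rfl fun u hu => by
        rw [latticeMean_update_of_notMem n z (Finset.mem_filter.1 hu).2]
    linarith
  have hsum := Finset.sum_le_sum hmin
  rw [Finset.sum_const, Finset.card_range, nsmul_eq_mul, Finset.sum_comm] at hsum
  simp only [← Finset.mul_sum] at hsum
  have hb : ∑ u ∈ A with m ∈ u, γ u * ∑ w ∈ Finset.range (2 ^ ℓ),
      latticeMean n (Function.update z m (2 * w + 1)) u ≤ (∑ u, γ u) * (1 / 2) := by
    rw [Finset.sum_mul]
    refine (Finset.sum_le_sum fun u hu => ?_).trans
      (Finset.sum_le_sum_of_subset_of_nonneg (Finset.subset_univ _) fun u _ _ => ?_)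
    · exact mul_le_mul_of_nonneg_left
        (sum_latticeMean_update_le ℓ z (Finset.mem_filter.1 hu).2) (hγ u).le
    · have := hγ u; positivity
  rw [le_div_iff₀ (by positivity), pow_succ]
  push_cast at hsum
  linarith

/-- CBC vectors have small Bernoulli means. -/
theorem latticeMean_le_of_isCBCVector {d : ℕ} {γ : Finset (Fin d) → ℝ} (hγ : ∀ u, 0 < γ u)
    (hnonneg : ∀ (n : ℕ) (z : Fin d → ℕ) (u : Finset (Fin d)), 0 < n → 0 ≤ latticeMean n z u)
    {ℓ : ℕ} {z : Fin d → ℕ} (hz : IsCBCVector (2 ^ ℓ) γ z) {u : Finset (Fin d)}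
    (hu : u.Nonempty) :
    latticeMean (2 ^ ℓ) z u ≤ (1 + (∑ v, γ v) / γ u) / 2 ^ ℓ := by
  have hs : 0 ≤ ∑ v, γ v := Finset.sum_nonneg fun v _ => (hγ v).le
  have hq : 0 ≤ (∑ v, γ v) / γ u := div_nonneg hs (hγ u).le
  cases ℓ with
  | zero =>
    -- With a single point there is nothing to average; the summand 1 in the constant covers this
    -- case.
    refine (latticeMean_le_one (by positivity) z u).trans ?_
    rw [pow_zero, div_one]
    linarith
  | succ ℓ =>
    -- The set `u` first enters the criterion at the step of its largest element. The other terms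
    -- there are nonnegative, so the bound on the sum bounds the `u`-term alone.
    have h := sum_weighted_latticeMean_le hγ hz (u.max' hu)
    have hmem : u ∈ ((Finset.Iic (u.max' hu)).powerset.filter Finset.Nonempty).filter
        (fun v => u.max' hu ∈ v) := by
      simp only [Finset.mem_filter, Finset.mem_powerset]
      exact ⟨⟨fun j hj => Finset.mem_Iic.2 (u.le_max' j hj), hu⟩, u.max'_mem hu⟩
    have h2 := (Finset.single_le_sum (f := fun v => γ v * latticeMean (2 ^ (ℓ + 1)) z v)
      (fun v _ => mul_nonneg (hγ v).le (hnonneg _ z v (by positivity))) hmem).trans h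
    rw [mul_comm, ← le_div_iff₀ (hγ u)] at h2
    refine h2.trans ?_
    rw [div_right_comm]
    gcongr
    linarith

/-! ### The kernel of the mean-plus-derivative representation -/

/-- The uniform probability measure on `[0, 1]`. -/
def unitMeasure : Measure ℝ := volume.restrict (Icc 0 1)

instance : IsProbabilityMeasure unitMeasure := ⟨by simp [unitMeasure]⟩

/-- The uniform probability measure on `[0, 1]^d`. -/
def cubeMeasure (d : ℕ) : Measure (Fin d → ℝ) := Measure.pi fun _ => unitMeasure

instance (d : ℕ) : IsProbabilityMeasure (cubeMeasure d) := by
  unfold cubeMeasure; infer_instance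

theorem volume_restrict_Icc_eq_cubeMeasure (d : ℕ) :
    (volume : Measure (Fin d → ℝ)).restrict (Icc 0 1) = cubeMeasure d := by
  rw [cubeMeasure, volume_pi, ← pi_univ_Icc]
  exact Measure.restrict_pi_pi _ _

theorem ae_mem_unit : ∀ᵐ y ∂unitMeasure, y ∈ Icc (0 : ℝ) 1 := ae_restrict_mem measurableSet_Icc

theorem ae_mem_cube (d : ℕ) : ∀ᵐ y ∂cubeMeasure d, y ∈ Icc (0 : Fin d → ℝ) 1 := by
  rw [← volume_restrict_Icc_eq_cubeMeasure]
  exact ae_restrict_mem measurableSet_Icc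

theorem integral_unitMeasure (f : ℝ → ℝ) : ∫ y, f y ∂unitMeasure = ∫ y in (0 : ℝ)..1, f y := by
  rw [unitMeasure, integral_Icc_eq_integral_Ioc, intervalIntegral.integral_of_le zero_le_one]

/-- The kernel `k(x, y) = y - 1_{x < y}`. -/
def kernel (x y : ℝ) : ℝ := y - if x < y then 1 else 0

theorem measurable_kernel : Measurable fun p : ℝ × ℝ => kernel p.1 p.2 :=
  measurable_snd.sub (Measurable.ite (measurableSet_lt measurable_fst measurable_snd)
    measurable_const measurable_const)

theorem abs_kernel_le {x y : ℝ} (hy : y ∈ Icc (0 : ℝ) 1) : |kernel x y| ≤ 1 := by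
  obtain ⟨h0, h1⟩ := hy
  unfold kernel
  split_ifs <;> rw [abs_le] <;> constructor <;> linarith

theorem intervalIntegral_quadratic (a b c₀ c₁ c₂ : ℝ) :
    ∫ t in a..b, (c₀ + c₁ * t + c₂ * t ^ 2) =
      c₀ * (b - a) + c₁ * (b ^ 2 - a ^ 2) / 2 + c₂ * (b ^ 3 - a ^ 3) / 3 := by
  rw [intervalIntegral.integral_eq_sub_of_hasDerivAt
    (f := fun t => c₀ * t + c₁ * t ^ 2 / 2 + c₂ * t ^ 3 / 3)]
  · ring
  · intro t _
    have h := (((hasDerivAt_id t).const_mul c₀).add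
      (((hasDerivAt_pow 2 t).const_mul c₁).div_const 2)).add
      (((hasDerivAt_pow 3 t).const_mul c₂).div_const 3)
    refine HasDerivAt.congr_deriv h ?_
    push_cast
    ring
  · exact Continuous.intervalIntegrable (by fun_prop) _ _

theorem intervalIntegral_congr_Ioo {a b : ℝ} (hab : a ≤ b) {f g : ℝ → ℝ}
    (h : ∀ t ∈ Ioo a b, f t = g t) : ∫ t in a..b, f t = ∫ t in a..b, g t := by
  rw [intervalIntegral.integral_of_le hab, intervalIntegral.integral_of_le hab,
    integral_Ioc_eq_integral_Ioo, integral_Ioc_eq_integral_Ioo]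
  exact setIntegral_congr_fun measurableSet_Ioo h

theorem integrable_of_measurable_bound {α : Type*} [MeasurableSpace α] {μ : Measure α}
    [IsFiniteMeasure μ] {f : α → ℝ} (hf : Measurable f) {C : ℝ} (h : ∀ᵐ x ∂μ, |f x| ≤ C) :
    Integrable f μ :=
  Integrable.of_bound hf.aestronglyMeasurable C h

theorem intervalIntegrable_of_measurable_bound {f : ℝ → ℝ} (hf : Measurable f) {C : ℝ} {a b : ℝ}
    (ha : a ∈ Icc (0 : ℝ) 1) (hb : b ∈ Icc (0 : ℝ) 1) (h : ∀ x ∈ Icc (0 : ℝ) 1, |f x| ≤ C) :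
    IntervalIntegrable f volume a b := by
  have h1 : IntegrableOn f (Icc 0 1) := integrable_of_measurable_bound hf (C := C)
    ((ae_restrict_mem measurableSet_Icc).mono h)
  refine IntervalIntegrable.mono_set (a := 0) (b := 1) ?_ ?_
  · rw [intervalIntegrable_iff_integrableOn_Icc_of_le zero_le_one]; exact h1
  · rw [uIcc_of_le zero_le_one]; exact uIcc_subset_Icc ha hb

theorem abs_kernel_mul_kernel_le {x x' y : ℝ} (hy : y ∈ Icc (0 : ℝ) 1) :
    |kernel x y * kernel x' y| ≤ 1 := by
  rw [abs_mul]
  exact mul_le_one₀ (abs_kernel_le hy) (abs_nonneg _) (abs_kernel_le hy)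

theorem measurable_kernel_right (x : ℝ) : Measurable fun y => kernel x y :=
  measurable_kernel.comp (measurable_const.prodMk measurable_id)

theorem integral_kernel_mul_kernel {x x' : ℝ} (hx : x ∈ Icc (0 : ℝ) 1) (hx' : x' ∈ Icc (0 : ℝ) 1) :
    ∫ y, kernel x y * kernel x' y ∂unitMeasure =
      1 / 3 + (x ^ 2 + x' ^ 2) / 2 - max x x' := by
  wlog hle : x ≤ x' generalizing x x'
  · rw [max_comm, add_comm (x ^ 2), ← this hx' hx (le_of_not_ge hle)]
    simp only [mul_comm]
  have hi : ∀ {a b : ℝ}, a ∈ Icc (0 : ℝ) 1 → b ∈ Icc (0 : ℝ) 1 →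
      IntervalIntegrable (fun y => kernel x y * kernel x' y) volume a b := fun ha hb =>
    intervalIntegrable_of_measurable_bound
      ((measurable_kernel_right x).mul (measurable_kernel_right x')) ha hb
      fun y hy => abs_kernel_mul_kernel_le hy
  have h0 : (0 : ℝ) ∈ Icc (0 : ℝ) 1 := by simp
  have h1 : (1 : ℝ) ∈ Icc (0 : ℝ) 1 := by simp
  rw [integral_unitMeasure, ← intervalIntegral.integral_add_adjacent_intervals (hi h0 hx) (hi hx h1),
    ← intervalIntegral.integral_add_adjacent_intervals (hi hx hx') (hi hx' h1), max_eq_right hle,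
    intervalIntegral_congr_Ioo hx.1 (g := fun y => 0 + 0 * y + 1 * y ^ 2),
    intervalIntegral_congr_Ioo hle (g := fun y => 0 + (-1) * y + 1 * y ^ 2),
    intervalIntegral_congr_Ioo hx'.2 (g := fun y => 1 + (-2) * y + 1 * y ^ 2)]
  · simp only [intervalIntegral_quadratic]
    ring
  · rintro y ⟨hy, hy'⟩
    rw [kernel, kernel, if_pos hy, if_pos (hle.trans_lt hy)]
    ring
  · rintro y ⟨hy, hy'⟩
    rw [kernel, kernel, if_pos hy, if_neg hy'.not_gt]
    ring
  · rintro y ⟨hy, hy'⟩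
    rw [kernel, kernel, if_neg hy'.not_gt, if_neg (hy'.trans_le hle).not_gt]
    ring

/-- The inner integral is a 1-periodic function of the shift, so `b` can be translated away, leaving
a piecewise quadratic that depends only on the fractional part of `a - b`. -/
theorem integral_shift_kernel (a b : ℝ) :
    ∫ t, ∫ y, kernel (Int.fract (a + t)) y * kernel (Int.fract (b + t)) y ∂unitMeasure
      ∂unitMeasure = bernoulliTwo (Int.fract (a - b)) := by
  have hmem : ∀ x : ℝ, Int.fract x ∈ Icc (0 : ℝ) 1 := fun x =>
    ⟨Int.fract_nonneg x, (Int.fract_lt_one x).le⟩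
  simp only [integral_kernel_mul_kernel (hmem _) (hmem _)]
  set c := Int.fract (a - b) with hc
  have hc0 : 0 ≤ c := Int.fract_nonneg _
  have hc1 : c < 1 := Int.fract_lt_one _
  let Φ : ℝ → ℝ := fun t => 1 / 3 + (Int.fract (c + t) ^ 2 + Int.fract t ^ 2) / 2 -
    max (Int.fract (c + t)) (Int.fract t)
  have hΦ : Function.Periodic Φ 1 := fun t => by
    simp only [Φ, ← add_assoc, Int.fract_add_one]
  have hshift : ∀ t, Int.fract (a + t) = Int.fract (c + (b + t)) := fun t => by
    rw [show a + t = c + (b + t) + (⌊a - b⌋ : ℤ) by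
      rw [hc, Int.fract]; ring, Int.fract_add_intCast]
  have hint : ∀ {x y : ℝ}, x ∈ Icc (0 : ℝ) 1 → y ∈ Icc (0 : ℝ) 1 →
      IntervalIntegrable Φ volume x y := fun hx hy =>
    intervalIntegrable_of_measurable_bound (C := 2) (by fun_prop) hx hy fun t _ => by
      have h1 := hmem (c + t)
      have h2 := hmem t
      have h3 : max (Int.fract (c + t)) (Int.fract t) ≤ 1 := max_le h1.2 h2.2
      have h4 : 0 ≤ max (Int.fract (c + t)) (Int.fract t) := le_max_of_le_left h1.1
      have h5 : Int.fract (c + t) ^ 2 ≤ 1 := pow_le_one₀ h1.1 h1.2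
      have h6 : Int.fract t ^ 2 ≤ 1 := pow_le_one₀ h2.1 h2.2
      have h7 := sq_nonneg (Int.fract (c + t))
      have h8 := sq_nonneg (Int.fract t)
      simp only [Φ]
      rw [abs_le]
      constructor <;> linarith
  simp only [hshift]
  rw [integral_unitMeasure]
  change ∫ t in (0 : ℝ)..1, Φ (b + t) = _
  rw [intervalIntegral.integral_comp_add_left Φ b, add_zero, hΦ.intervalIntegral_add_eq b 0,
    zero_add]
  -- The point `c + t` wraps around at `t = 1 - c`; this also decides which argument is the maximum.
  have hm : 1 - c ∈ Icc (0 : ℝ) 1 := ⟨by linarith, by linarith⟩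
  rw [← intervalIntegral.integral_add_adjacent_intervals (hint (by simp) hm) (hint hm (by simp)),
    intervalIntegral_congr_Ioo hm.1
      (g := fun t => (1 / 3 + c ^ 2 / 2 - c) + (c - 1) * t + 1 * t ^ 2),
    intervalIntegral_congr_Ioo hm.2
      (g := fun t => (1 / 3 + (c - 1) ^ 2 / 2) + (c - 1 - 1) * t + 1 * t ^ 2)]
  · simp only [intervalIntegral_quadratic, bernoulliTwo]
    ring
  · rintro t ⟨h1, h2⟩
    have e1 : Int.fract t = t := Int.fract_eq_self.2 ⟨by linarith, h2⟩
    have e2 : Int.fract (c + t) = c + t - 1 := by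
      rw [← Int.fract_sub_one]
      exact Int.fract_eq_self.2 ⟨by linarith, by linarith⟩
    simp only [Φ, e1, e2]
    rw [max_eq_right (by linarith)]
    ring
  · rintro t ⟨h1, h2⟩
    have e1 : Int.fract t = t := Int.fract_eq_self.2 ⟨h1.le, by linarith⟩
    have e2 : Int.fract (c + t) = c + t :=
      Int.fract_eq_self.2 ⟨by linarith, by linarith⟩
    simp only [Φ, e1, e2]
    rw [max_eq_left (by linarith)]
    ring

/-! ### The Bernoulli mean as an averaged square -/

theorem integral_cube_prod {d : ℕ} (u : Finset (Fin d)) (φ : Fin d → ℝ → ℝ) :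
    ∫ y, ∏ j ∈ u, φ j (y j) ∂cubeMeasure d = ∏ j ∈ u, ∫ t, φ j t ∂unitMeasure := by
  have h := integral_fintype_prod_eq_prod (𝕜 := ℝ) (E := fun _ : Fin d => ℝ)
    (fun j t => if j ∈ u then φ j t else 1) (μ := fun _ : Fin d => unitMeasure)
  have e : ∀ y : Fin d → ℝ, ∏ j, (if j ∈ u then φ j (y j) else 1) = ∏ j ∈ u, φ j (y j) :=
    fun y => by rw [Finset.prod_ite_mem, Finset.univ_inter]
  simp only [e] at h
  rw [cubeMeasure, h, ← Finset.univ_inter u, ← Finset.prod_ite_mem]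
  refine Finset.prod_congr rfl fun j _ => ?_
  by_cases hj : j ∈ u <;> simp [hj]

/-- The mean over the lattice of the product kernel at the shifted points. -/
def kernelMean {d : ℕ} (n : ℕ) (z : Fin d → ℕ) (u : Finset (Fin d)) (Δ y : Fin d → ℝ) : ℝ :=
  ∑ i ∈ Finset.Icc 1 n, (1 / (n : ℝ)) * ∏ j ∈ u, kernel (shiftedPoint n z Δ i j) (y j)

theorem measurable_shiftedPoint {d : ℕ} (n : ℕ) (z : Fin d → ℕ) (i : ℕ) (j : Fin d) :
    Measurable fun Δ : Fin d → ℝ => shiftedPoint n z Δ i j :=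
  measurable_fract.comp ((measurable_pi_apply j).const_add _)

theorem shiftedPoint_mem {d : ℕ} (n : ℕ) (z : Fin d → ℕ) (Δ : Fin d → ℝ) (i : ℕ) :
    shiftedPoint n z Δ i ∈ Icc (0 : Fin d → ℝ) 1 :=
  ⟨fun _ => Int.fract_nonneg _, fun _ => (Int.fract_lt_one _).le⟩

theorem measurable_kernel_shiftedPoint {d : ℕ} (n : ℕ) (z : Fin d → ℕ) (i : ℕ) (j : Fin d) :
    Measurable fun p : (Fin d → ℝ) × (Fin d → ℝ) => kernel (shiftedPoint n z p.1 i j) (p.2 j) :=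
  measurable_kernel.comp (((measurable_shiftedPoint n z i j).comp measurable_fst).prodMk
    ((measurable_pi_apply j).comp measurable_snd))

theorem measurable_kernelMean {d : ℕ} (n : ℕ) (z : Fin d → ℕ) (u : Finset (Fin d)) :
    Measurable fun p : (Fin d → ℝ) × (Fin d → ℝ) => kernelMean n z u p.1 p.2 :=
  Finset.measurable_fun_sum _ fun i _ => (Finset.measurable_fun_prod _ fun j _ =>
    measurable_kernel_shiftedPoint n z i j).const_mul _

theorem integral_kernelMean_sq_aux {d : ℕ} (n : ℕ) (z : Fin d → ℕ) (u : Finset (Fin d)) :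
    ∫ p, kernelMean n z u p.1 p.2 ^ 2 ∂(cubeMeasure d).prod (cubeMeasure d) =
      ∑ i ∈ Finset.Icc 1 n, ∑ i' ∈ Finset.Icc 1 n, (1 / (n : ℝ)) * (1 / n) *
        ∏ j ∈ u, bernoulliTwo (Int.fract (latticePoint n z i j - latticePoint n z i' j)) := by
  have hexp : ∀ p : (Fin d → ℝ) × (Fin d → ℝ), kernelMean n z u p.1 p.2 ^ 2 =
      ∑ i ∈ Finset.Icc 1 n, ∑ i' ∈ Finset.Icc 1 n, (1 / (n : ℝ)) * (1 / n) *
        ∏ j ∈ u, (kernel (shiftedPoint n z p.1 i j) (p.2 j) *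
          kernel (shiftedPoint n z p.1 i' j) (p.2 j)) := by
    intro p
    rw [pow_two, kernelMean, Finset.sum_mul_sum]
    refine Finset.sum_congr rfl fun i _ => Finset.sum_congr rfl fun i' _ => ?_
    rw [Finset.prod_mul_distrib]
    ring
  have hint : ∀ i i' : ℕ, Integrable (fun p : (Fin d → ℝ) × (Fin d → ℝ) =>
      (1 / (n : ℝ)) * (1 / n) * ∏ j ∈ u, (kernel (shiftedPoint n z p.1 i j) (p.2 j) *
          kernel (shiftedPoint n z p.1 i' j) (p.2 j))) ((cubeMeasure d).prod (cubeMeasure d)) := by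
    intro i i'
    refine Integrable.const_mul (integrable_of_measurable_bound (C := 1)
      (Finset.measurable_fun_prod _ fun j _ => (measurable_kernel_shiftedPoint n z i j).mul
        (measurable_kernel_shiftedPoint n z i' j)) ?_) _
    have : ∀ᵐ p ∂(cubeMeasure d).prod (cubeMeasure d), p.2 ∈ Icc (0 : Fin d → ℝ) 1 :=
      Measure.quasiMeasurePreserving_snd.ae (ae_mem_cube d)
    filter_upwards [this] with p hp
    rw [Finset.abs_prod]
    exact Finset.prod_le_one (fun _ _ => abs_nonneg _) fun j _ =>
      abs_kernel_mul_kernel_le ⟨hp.1 j, hp.2 j⟩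
  simp only [hexp]
  rw [integral_finsetSum _ fun i _ => integrable_finsetSum _ fun i' _ => hint i i']
  refine Finset.sum_congr rfl fun i _ => ?_
  rw [integral_finsetSum _ fun i' _ => hint i i']
  refine Finset.sum_congr rfl fun i' _ => ?_
  rw [integral_prod _ (hint i i')]
  simp only [integral_const_mul]
  congr 1
  have h1 : ∀ Δ : Fin d → ℝ, ∫ y, ∏ j ∈ u, (kernel (shiftedPoint n z Δ i j) (y j) *
      kernel (shiftedPoint n z Δ i' j) (y j)) ∂cubeMeasure d =
      ∏ j ∈ u, ∫ t, kernel (shiftedPoint n z Δ i j) t * kernel (shiftedPoint n z Δ i' j) t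
        ∂unitMeasure := fun Δ => integral_cube_prod u fun j t =>
      kernel (shiftedPoint n z Δ i j) t * kernel (shiftedPoint n z Δ i' j) t
  simp only [h1]
  simp only [shiftedPoint]
  rw [integral_cube_prod u fun j δ => ∫ t, kernel (Int.fract (latticePoint n z i j + δ)) t *
      kernel (Int.fract (latticePoint n z i' j + δ)) t ∂unitMeasure]
  exact Finset.prod_congr rfl fun j _ => integral_shift_kernel _ _

theorem fract_latticePoint_sub {d : ℕ} (n : ℕ) (z : Fin d → ℕ) (i i' : ℕ) (j : Fin d) :
    Int.fract (latticePoint n z i j - latticePoint n z i' j) =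
      Int.fract (((i : ℝ) - i') * z j / n) := by
  rw [Int.fract_eq_fract]
  refine ⟨⌊(i' : ℝ) * z j / n⌋ - ⌊(i : ℝ) * z j / n⌋, ?_⟩
  simp only [latticePoint, Int.fract]
  push_cast
  ring

theorem sum_Icc_add_period {n : ℕ} {f : ℤ → ℝ} (hf : ∀ m, f (m + n) = f m) (c : ℤ) :
    ∑ i ∈ Finset.Icc 1 n, f (i + c) = ∑ i ∈ Finset.Icc 1 n, f i := by
  have key : ∀ c : ℤ, ∑ i ∈ Finset.Icc 1 n, f (i + (c + 1)) = ∑ i ∈ Finset.Icc 1 n, f (i + c) := by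
    intro c
    have h : ∀ c : ℤ, ∑ i ∈ Finset.Icc 1 n, f (i + c) = ∑ i ∈ Finset.range n, f (i + c) :=
      fun c => sum_Icc_eq_sum_range (f := fun i : ℕ => f (i + c)) (by
        rw [add_comm, hf]; simp)
    rw [h (c + 1)]
    have h2 := Finset.sum_range_succ' (fun i : ℕ => f (i + c)) n
    rw [Finset.sum_range_succ, ← h c] at h2
    have h3 : f (n + c) = f ((0 : ℕ) + c) := by rw [add_comm, hf]; simp
    simp only [h3, add_left_inj, h c] at h2 ⊢
    rw [h2]
    refine Finset.sum_congr rfl fun i _ => ?_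
    push_cast
    congr 1
    ring
  induction c using Int.induction_on with
  | zero => simp
  | succ c ih => rw [key, ih]
  | pred c ih => rw [← ih, ← key (-(c : ℤ) - 1)]; simp

/-- Expanding the square leaves `B₂` at differences of lattice points. These depend on `i - i'`
modulo `n` only, so each of the `n` values of `i'` contributes the same sum. -/
theorem integral_kernelMean_sq {d n : ℕ} (hn : 0 < n) (z : Fin d → ℕ) (u : Finset (Fin d)) :
    ∫ p, kernelMean n z u p.1 p.2 ^ 2 ∂(cubeMeasure d).prod (cubeMeasure d) =
      latticeMean n z u := by
  have hn' : (n : ℝ) ≠ 0 := by positivity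
  rw [integral_kernelMean_sq_aux]
  let f : ℤ → ℝ := fun m => ∏ j ∈ u, bernoulliTwo (Int.fract ((m : ℝ) * z j / n))
  have hf : ∀ m, f (m + n) = f m := fun m => Finset.prod_congr rfl fun j _ => by
    have : ((m + n : ℤ) : ℝ) * z j / n = (m : ℝ) * z j / n + (z j : ℕ) := by
      push_cast; field_simp
    rw [this, bernoulliTwo_fract_add_natCast]
  have h : ∀ i i' : ℕ, ∏ j ∈ u, bernoulliTwo
      (Int.fract (latticePoint n z i j - latticePoint n z i' j)) = f (i + -(i' : ℤ)) := by
    intro i i'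
    refine Finset.prod_congr rfl fun j _ => ?_
    rw [fract_latticePoint_sub]
    push_cast
    rw [sub_eq_add_neg]
  rw [Finset.sum_comm]
  simp only [h, ← Finset.mul_sum, sum_Icc_add_period hf]
  rw [Finset.sum_const, Nat.card_Icc, latticeMean]
  simp only [f, latticePoint, Int.cast_natCast, nsmul_eq_mul, Nat.add_sub_cancel]
  field_simp

/-- Not visible from the signs of `B₂`; it comes from the representation as the integral of a
square. -/
theorem latticeMean_nonneg {d n : ℕ} (hn : 0 < n) (z : Fin d → ℕ) (u : Finset (Fin d)) :
    0 ≤ latticeMean n z u := by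
  rw [← integral_kernelMean_sq hn]
  exact integral_nonneg fun p => sq_nonneg _

/-! ### Functions with bounded derivatives on the unit cube -/

/-- `f` is smooth on `[0, 1]^d` with derivatives of order at most `N` bounded by `M`. -/
def BoundedDerivs {d : ℕ} (N : ℕ) (M : ℝ) (f : (Fin d → ℝ) → ℝ) : Prop :=
  ContDiffOn ℝ ∞ f (Icc 0 1) ∧
    ∀ i ≤ N, ∀ x ∈ Icc (0 : Fin d → ℝ) 1, ‖iteratedFDerivWithin ℝ i f (Icc 0 1) x‖ ≤ M

/-- The partial derivative relative to the unit cube. -/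
def cubePartial {d : ℕ} (j : Fin d) (f : (Fin d → ℝ) → ℝ) (x : Fin d → ℝ) : ℝ :=
  fderivWithin ℝ f (Icc 0 1) x (Pi.single j 1)

theorem uniqueDiffOn_Icc_pi {d : ℕ} {a b : Fin d → ℝ} (h : ∀ i, a i < b i) :
    UniqueDiffOn ℝ (Icc a b) := by
  rw [← pi_univ_Icc]
  exact UniqueDiffOn.univ_pi fun i => uniqueDiffOn_Icc (h i)

theorem uniqueDiffOn_cube (d : ℕ) : UniqueDiffOn ℝ (Icc (0 : Fin d → ℝ) 1) :=
  uniqueDiffOn_Icc_pi fun _ => zero_lt_one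

theorem BoundedDerivs.continuousOn {d N : ℕ} {M : ℝ} {f : (Fin d → ℝ) → ℝ}
    (hf : BoundedDerivs N M f) : ContinuousOn f (Icc 0 1) := hf.1.continuousOn

theorem BoundedDerivs.mono {d N N' : ℕ} {M : ℝ} {f : (Fin d → ℝ) → ℝ}
    (hf : BoundedDerivs N M f) (h : N' ≤ N) : BoundedDerivs N' M f :=
  ⟨hf.1, fun i hi => hf.2 i (hi.trans h)⟩

theorem BoundedDerivs.abs_le {d N : ℕ} {M : ℝ} {f : (Fin d → ℝ) → ℝ}
    (hf : BoundedDerivs N M f) {x : Fin d → ℝ} (hx : x ∈ Icc (0 : Fin d → ℝ) 1) : |f x| ≤ M := by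
  have := hf.2 0 (Nat.zero_le _) x hx
  rwa [norm_iteratedFDerivWithin_zero] at this

theorem BoundedDerivs.nonneg {d N : ℕ} {M : ℝ} {f : (Fin d → ℝ) → ℝ}
    (hf : BoundedDerivs N M f) : 0 ≤ M :=
  (abs_nonneg _).trans (hf.abs_le (x := 0) ⟨le_rfl, fun _ => zero_le_one⟩)

theorem BoundedDerivs.cubePartial {d N : ℕ} {M : ℝ} {f : (Fin d → ℝ) → ℝ}
    (hf : BoundedDerivs (N + 1) M f) (j : Fin d) : BoundedDerivs N M (cubePartial j f) := by
  have hD : ContDiffOn ℝ ∞ (fderivWithin ℝ f (Icc 0 1)) (Icc 0 1) :=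
    hf.1.fderivWithin (uniqueDiffOn_cube d) (by simp)
  refine ⟨hD.clm_apply contDiffOn_const, fun i hi x hx => ?_⟩
  refine (norm_iteratedFDerivWithin_clm_apply_const (hD x hx) (uniqueDiffOn_cube d) hx
    (by exact_mod_cast le_top)).trans ?_
  rw [norm_iteratedFDerivWithin_fderivWithin (uniqueDiffOn_cube d) hx, Pi.norm_single, norm_one,
    one_mul]
  exact hf.2 _ (by omega) x hx

theorem update_mem_cube {d : ℕ} {x : Fin d → ℝ} (hx : x ∈ Icc (0 : Fin d → ℝ) 1) (j : Fin d)
    {t : ℝ} (ht : t ∈ Icc (0 : ℝ) 1) : Function.update x j t ∈ Icc (0 : Fin d → ℝ) 1 := by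
  rw [← pi_univ_Icc] at hx ⊢
  intro i _
  by_cases h : i = j
  · subst h; simpa using ht
  · simpa [h] using hx i (mem_univ i)

theorem piecewise_mem_cube {d : ℕ} {x y : Fin d → ℝ} (hx : x ∈ Icc (0 : Fin d → ℝ) 1)
    (hy : y ∈ Icc (0 : Fin d → ℝ) 1) (T : Finset (Fin d)) :
    T.piecewise y x ∈ Icc (0 : Fin d → ℝ) 1 :=
  T.piecewise_mem_Icc_of_mem_of_mem hy hx

theorem BoundedDerivs.hasDerivWithinAt {d N : ℕ} {M : ℝ} {f : (Fin d → ℝ) → ℝ}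
    (hf : BoundedDerivs N M f) {x : Fin d → ℝ} (hx : x ∈ Icc (0 : Fin d → ℝ) 1) (j : Fin d)
    {t : ℝ} (ht : t ∈ Icc (0 : ℝ) 1) :
    HasDerivWithinAt (fun t => f (Function.update x j t))
      (NestedQMC.cubePartial j f (Function.update x j t)) (Icc 0 1) t := by
  have hd : DifferentiableWithinAt ℝ f (Icc 0 1) (Function.update x j t) :=
    (hf.1 _ (update_mem_cube hx j ht)).differentiableWithinAt (by simp)
  exact hd.hasFDerivWithinAt.comp_hasDerivWithinAt (f := Function.update x j) t
    (hasDerivAt_update x j t).hasDerivWithinAt fun s hs => update_mem_cube hx j hs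

theorem continuousOn_comp_update {d : ℕ} {f : (Fin d → ℝ) → ℝ} (hf : ContinuousOn f (Icc 0 1))
    {x : Fin d → ℝ} (hx : x ∈ Icc (0 : Fin d → ℝ) 1) (j : Fin d) :
    ContinuousOn (fun t => f (Function.update x j t)) (Icc (0 : ℝ) 1) := by
  have hc : Continuous fun t : ℝ => Function.update x j t := continuous_const.update j continuous_id
  exact hf.comp hc.continuousOn fun _ ht => update_mem_cube hx j ht

theorem ContinuousOn.integrable_unit {φ : ℝ → ℝ} (h : ContinuousOn φ (Icc 0 1)) :
    Integrable φ unitMeasure := h.integrableOn_compact isCompact_Icc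

theorem ContinuousOn.integrable_cube {d : ℕ} {f : (Fin d → ℝ) → ℝ}
    (h : ContinuousOn f (Icc 0 1)) : Integrable f (cubeMeasure d) := by
  rw [← volume_restrict_Icc_eq_cubeMeasure]
  exact h.integrableOn_compact isCompact_Icc

theorem integrable_kernel_mul {φ : ℝ → ℝ} (x : ℝ) (h : ContinuousOn φ (Icc 0 1)) :
    Integrable (fun t => kernel x t * φ t) unitMeasure :=
  (ContinuousOn.integrable_unit h).bdd_mul (c := 1)
    (measurable_kernel_right x).aestronglyMeasurable (ae_mem_unit.mono fun _ => abs_kernel_le)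

/-- The mean-plus-derivative representation of a `C¹` function. -/
theorem eq_integral_add_integral_kernel {φ φ' : ℝ → ℝ}
    (hφ' : ContinuousOn φ' (Icc 0 1)) (h : ∀ t ∈ Icc (0 : ℝ) 1, HasDerivWithinAt φ (φ' t) (Icc 0 1) t)
    {x : ℝ} (hx : x ∈ Icc (0 : ℝ) 1) :
    φ x = ∫ t, φ t ∂unitMeasure + ∫ t, kernel x t * φ' t ∂unitMeasure := by
  have hφ : ContinuousOn φ (Icc 0 1) := fun t ht => (h t ht).continuousWithinAt
  have hd : ∀ t ∈ Ioo (0 : ℝ) 1, HasDerivAt φ (φ' t) t := fun t ht =>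
    (h t (Ioo_subset_Icc_self ht)).hasDerivAt (Icc_mem_nhds ht.1 ht.2)
  -- The two parts of the kernel give `φ 1 - ∫ φ` by parts and `φ 1 - φ x` by the fundamental
  -- theorem; `φ 1` drops out of the difference.
  have h1 : ∫ t in (0 : ℝ)..1, t * φ' t = φ 1 - ∫ t in (0 : ℝ)..1, φ t := by
    rw [intervalIntegral.integral_mul_deriv_eq_deriv_mul_of_hasDeriv_right (u := fun t => t)
      (v := φ) (u' := fun _ => 1)]
    · simp
    · fun_prop
    · rwa [uIcc_of_le zero_le_one]
    · intro t _
      exact (hasDerivAt_id t).hasDerivWithinAt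
    · intro t ht
      rw [min_eq_left zero_le_one, max_eq_right zero_le_one] at ht
      exact (hd t ht).hasDerivWithinAt
    · simp
    · exact ContinuousOn.intervalIntegrable (by rwa [uIcc_of_le zero_le_one])
  have h2 : ∫ t in x..1, φ' t = φ 1 - φ x := by
    refine intervalIntegral.integral_eq_sub_of_hasDeriv_right ?_ ?_ ?_
    · rw [uIcc_of_le hx.2]; exact hφ.mono (Icc_subset_Icc_left hx.1)
    · intro t ht
      rw [min_eq_left hx.2, max_eq_right hx.2] at ht
      exact (hd t ⟨hx.1.trans_lt ht.1, ht.2⟩).hasDerivWithinAt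
    · exact ContinuousOn.intervalIntegrable
        (by rw [uIcc_of_le hx.2]; exact hφ'.mono (Icc_subset_Icc_left hx.1))
  have hind : ∀ t, kernel x t * φ' t = t * φ' t - (Ioi x).indicator φ' t := by
    intro t
    by_cases ht : x < t
    · rw [kernel, if_pos ht, indicator_of_mem (show t ∈ Ioi x from ht)]; ring
    · rw [kernel, if_neg ht, indicator_of_notMem (show t ∉ Ioi x from ht)]; ring
  have h3 : ∫ t, (Ioi x).indicator φ' t ∂unitMeasure = ∫ t in x..1, φ' t := by
    rw [unitMeasure, setIntegral_indicator measurableSet_Ioi, intervalIntegral.integral_of_le hx.2]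
    congr 2
    ext t
    simp only [mem_inter_iff, mem_Icc, mem_Ioi, mem_Ioc]
    exact ⟨fun ht => ⟨ht.2, ht.1.2⟩, fun ht => ⟨⟨hx.1.trans ht.1.le, ht.2⟩, ht.1⟩⟩
  simp only [hind]
  rw [integral_sub (f := fun t => t * φ' t)
    (ContinuousOn.integrable_unit (continuousOn_id.mul hφ'))
    ((ContinuousOn.integrable_unit hφ').indicator measurableSet_Ioi), h3, h2]
  rw [integral_unitMeasure, integral_unitMeasure]
  change _ = _ + ((∫ t in (0 : ℝ)..1, t * φ' t) - _)
  rw [h1]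
  ring

/-! ### Resampling one coordinate -/

/-- Replacing one coordinate by an independent uniform copy preserves the product law. This is the
Fubini step that splits off a coordinate without changing the index type. -/
theorem measurePreserving_update {d : ℕ} (j : Fin d) :
    MeasurePreserving (fun p : ℝ × (Fin d → ℝ) => Function.update p.2 j p.1)
      (unitMeasure.prod (cubeMeasure d)) (cubeMeasure d) := by
  have hm : Measurable (fun p : ℝ × (Fin d → ℝ) => Function.update p.2 j p.1) := by
    rw [measurable_pi_iff]
    intro i
    by_cases h : i = j
    · subst h; simpa using measurable_fst
    · simpa [h, Function.comp_def] using
        (measurable_pi_apply i).comp (measurable_snd : Measurable (Prod.snd : ℝ × (Fin d → ℝ) → _))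
  refine ⟨hm, ?_⟩
  symm
  refine Measure.pi_eq fun S hS => ?_
  rw [Measure.map_apply hm (MeasurableSet.univ_pi hS)]
  have : (fun p : ℝ × (Fin d → ℝ) => Function.update p.2 j p.1) ⁻¹' univ.pi S =
      S j ×ˢ univ.pi (Function.update S j univ) := by
    ext p
    simp only [mem_preimage, mem_univ_pi, mem_prod]
    constructor
    · intro h
      refine ⟨by simpa using h j, fun i => ?_⟩
      by_cases hi : i = j
      · subst hi; simp
      · simpa [hi] using h i
    · rintro ⟨h1, h2⟩ i
      by_cases hi : i = j
      · subst hi; simpa using h1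
      · simpa [hi] using h2 i
  rw [this, Measure.prod_prod, cubeMeasure, Measure.pi_pi, ← Finset.mul_prod_erase _ _ (Finset.mem_univ j),
    ← Finset.mul_prod_erase _ (fun i => unitMeasure (S i)) (Finset.mem_univ j)]
  simp only [Function.update_self, measure_univ, one_mul]
  congr 1
  exact Finset.prod_congr rfl fun i hi => by simp [Finset.ne_of_mem_erase hi]

theorem integrable_integral_update {d : ℕ} (j : Fin d) {H : (Fin d → ℝ) → ℝ}
    (hH : Integrable H (cubeMeasure d)) :
    Integrable (fun t => ∫ y, H (Function.update y j t) ∂cubeMeasure d) unitMeasure :=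
  ((measurePreserving_update j).integrable_comp_of_integrable hH).integral_prod_left

theorem integral_integral_update {d : ℕ} (j : Fin d) {H : (Fin d → ℝ) → ℝ}
    (hH : Integrable H (cubeMeasure d)) :
    ∫ t, ∫ y, H (Function.update y j t) ∂cubeMeasure d ∂unitMeasure = ∫ y, H y ∂cubeMeasure d := by
  have hmp := measurePreserving_update j
  rw [← integral_prod (f := fun p : ℝ × (Fin d → ℝ) => H (Function.update p.2 j p.1))
    (hmp.integrable_comp_of_integrable hH)]
  conv_rhs => rw [← hmp.map_eq]
  rw [integral_map hmp.measurable.aemeasurable]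
  rw [hmp.map_eq]
  exact hH.aestronglyMeasurable

/-! ### Errors of linear functionals on functions with bounded mixed derivatives -/

section Duality

variable {d : ℕ} {ι : Type*} (s : Finset ι) (a : ι → ℝ) (x : ι → Fin d → ℝ)

/-- The `L¹` norm of a linear combination of product kernels. -/
def kernelNorm (u : Finset (Fin d)) : ℝ :=
  ∫ y, |∑ i ∈ s, a i * ∏ j ∈ u, kernel (x i j) (y j)| ∂cubeMeasure d

theorem kernelNorm_empty : kernelNorm s a x ∅ = |∑ i ∈ s, a i| := by
  simp [kernelNorm]

theorem integrable_kernel_sum (u : Finset (Fin d)) :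
    Integrable (fun y => |∑ i ∈ s, a i * ∏ j ∈ u, kernel (x i j) (y j)|) (cubeMeasure d) := by
  refine (integrable_finsetSum s fun i _ => Integrable.const_mul (integrable_of_measurable_bound
    (C := 1) ?_ ?_) _).abs
  · exact Finset.measurable_fun_prod _ fun j _ =>
      (measurable_kernel_right _).comp (measurable_pi_apply j)
  · filter_upwards [ae_mem_cube d] with y hy
    rw [Finset.abs_prod]
    exact Finset.prod_le_one (fun _ _ => abs_nonneg _) fun j _ => abs_kernel_le ⟨hy.1 j, hy.2 j⟩

theorem kernelNorm_update {u : Finset (Fin d)} {j : Fin d} (hj : j ∉ u) (t : ℝ) :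
    kernelNorm s a (fun i => Function.update (x i) j t) u = kernelNorm s a x u := by
  unfold kernelNorm
  congr 1
  ext y
  congr 1
  refine Finset.sum_congr rfl fun i _ => ?_
  congr 1
  refine Finset.prod_congr rfl fun m hm => ?_
  have : m ≠ j := fun e => hj (e ▸ hm)
  simp [this]

theorem kernelNorm_insert_aux {u : Finset (Fin d)} {j : Fin d} (hj : j ∉ u) (t : ℝ) :
    ∫ y, |∑ i ∈ s, a i * ∏ m ∈ insert j u, kernel (x i m) (Function.update y j t m)|
      ∂cubeMeasure d =
    kernelNorm s (fun i => a i * kernel (x i j) t) (fun i => Function.update (x i) j t) u := by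
  rw [kernelNorm_update _ _ _ hj]
  unfold kernelNorm
  congr 1
  ext y
  congr 1
  refine Finset.sum_congr rfl fun i _ => ?_
  rw [Finset.prod_insert hj, Function.update_self, mul_assoc]
  congr 2
  refine Finset.prod_congr rfl fun m hm => ?_
  have : m ≠ j := fun e => hj (e ▸ hm)
  simp [this]

/-- The `j`-th kernel factor is absorbed into the weights, so integrating over its variable `t`
restores the norm for the larger set. -/
theorem integral_kernelNorm_insert {u : Finset (Fin d)} {j : Fin d} (hj : j ∉ u) :
    ∫ t, kernelNorm s (fun i => a i * kernel (x i j) t) (fun i => Function.update (x i) j t) u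
      ∂unitMeasure = kernelNorm s a x (insert j u) := by
  simp only [← kernelNorm_insert_aux s a x hj]
  exact integral_integral_update j (integrable_kernel_sum s a x (insert j u))

theorem integrable_kernelNorm_insert {u : Finset (Fin d)} {j : Fin d} (hj : j ∉ u) :
    Integrable (fun t => kernelNorm s (fun i => a i * kernel (x i j) t)
      (fun i => Function.update (x i) j t) u) unitMeasure := by
  simp only [← kernelNorm_insert_aux s a x hj]
  exact integrable_integral_update j (integrable_kernel_sum s a x (insert j u))

end Duality

theorem continuousOn_piecewise {d : ℕ} {f : (Fin d → ℝ) → ℝ} (hf : ContinuousOn f (Icc 0 1))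
    {x : Fin d → ℝ} (hx : x ∈ Icc (0 : Fin d → ℝ) 1) (T : Finset (Fin d)) :
    ContinuousOn (fun y => f (T.piecewise y x)) (Icc 0 1) := by
  have hc : Continuous fun y : Fin d → ℝ => T.piecewise y x := by
    refine continuous_pi fun i => ?_
    by_cases h : i ∈ T
    · simpa [h] using continuous_apply i
    · simpa [h] using continuous_const
  exact hf.comp hc.continuousOn fun y hy => piecewise_mem_cube hx hy T

theorem insert_piecewise_update {d : ℕ} (T : Finset (Fin d)) (j : Fin d) (hj : j ∉ T)
    (x y : Fin d → ℝ) (t : ℝ) :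
    (insert j T).piecewise (Function.update y j t) x = T.piecewise y (Function.update x j t) := by
  ext i
  by_cases hi : i = j
  · subst hi; simp [hj]
  · by_cases hT : i ∈ T <;> simp [hi, hT]

theorem integral_piecewise_update {d : ℕ} {f : (Fin d → ℝ) → ℝ} (hf : ContinuousOn f (Icc 0 1))
    {x : Fin d → ℝ} (hx : x ∈ Icc (0 : Fin d → ℝ) 1) {T : Finset (Fin d)} {j : Fin d}
    (hj : j ∉ T) :
    Integrable (fun t => ∫ y, f (T.piecewise y (Function.update x j t)) ∂cubeMeasure d)
      unitMeasure ∧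
    ∫ t, ∫ y, f (T.piecewise y (Function.update x j t)) ∂cubeMeasure d ∂unitMeasure =
      ∫ y, f ((insert j T).piecewise y x) ∂cubeMeasure d := by
  have hH := ContinuousOn.integrable_cube (continuousOn_piecewise hf hx (insert j T))
  simp only [← insert_piecewise_update T j hj]
  exact ⟨integrable_integral_update j hH, integral_integral_update j hH⟩

/-- A Koksma–Hlawka type inequality by induction on the set of coordinates averaged out, with one
derivative spent per coordinate. Arbitrary weights are allowed because the step multiplies them by
kernels. Agreement of the points outside `T` makes the partial means equal for all points. -/
theorem abs_sum_sub_mean_le {d : ℕ} {ι : Type*} (s : Finset ι) {M : ℝ} (T : Finset (Fin d)) :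
    ∀ {f : (Fin d → ℝ) → ℝ}, BoundedDerivs T.card M f → ∀ (a : ι → ℝ) (x : ι → Fin d → ℝ),
      (∀ i, x i ∈ Icc (0 : Fin d → ℝ) 1) → (∀ i i', ∀ j ∉ T, x i j = x i' j) →
      |∑ i ∈ s, a i * (f (x i) - ∫ y, f (T.piecewise y (x i)) ∂cubeMeasure d)| ≤
        M * ∑ u ∈ T.powerset, if u = ∅ then 0 else kernelNorm s a x u := by
  induction T using Finset.induction_on with
  | empty => intro f _ a x _ _; simp
  | insert j T hj ih =>
    intro f hf a x hx hagree
    rw [Finset.card_insert_of_notMem hj] at hf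
    have hf' := hf.cubePartial j
    have hfT := hf.mono (Nat.le_succ T.card)
    have hM := hf.nonneg
    have hx' : ∀ t ∈ Icc (0 : ℝ) 1, ∀ i, Function.update (x i) j t ∈ Icc (0 : Fin d → ℝ) 1 :=
      fun t ht i => update_mem_cube (hx i) j ht
    have hagree' : ∀ t, ∀ i i', ∀ m ∉ T,
        Function.update (x i) j t m = Function.update (x i') j t m := by
      intro t i i' m hm
      by_cases h : m = j
      · subst h; simp
      · simpa [h] using hagree i i' m (by simp [h, hm])
    have hmean := fun i => integral_piecewise_update hf.continuousOn (hx i) hj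
    have hi1 : ∀ i, Integrable (fun t => f (Function.update (x i) j t)) unitMeasure := fun i =>
      ContinuousOn.integrable_unit (continuousOn_comp_update hf.continuousOn (hx i) j)
    have hi2 : ∀ i, Integrable (fun t => kernel (x i j) t *
        cubePartial j f (Function.update (x i) j t)) unitMeasure := fun i =>
      integrable_kernel_mul _ (continuousOn_comp_update hf'.continuousOn (hx i) j)
    -- The one-dimensional representation in coordinate `j`. The first integral will give the sets
    -- without `j`, the second those with `j`.
    have hrep : ∀ i, f (x i) - ∫ y, f ((insert j T).piecewise y (x i)) ∂cubeMeasure d =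
        ∫ t, (f (Function.update (x i) j t) -
          ∫ y, f (T.piecewise y (Function.update (x i) j t)) ∂cubeMeasure d) ∂unitMeasure +
        ∫ t, kernel (x i j) t * cubePartial j f (Function.update (x i) j t) ∂unitMeasure := by
      intro i
      have h := eq_integral_add_integral_kernel
        (continuousOn_comp_update hf'.continuousOn (hx i) j)
        (fun t ht => hf.hasDerivWithinAt (hx i) j ht) (x := x i j) ⟨(hx i).1 j, (hx i).2 j⟩
      rw [Function.update_eq_self] at h
      rw [integral_sub (hi1 i) (hmean i).1, (hmean i).2, h]
      ring
    have hA : ∑ i ∈ s, a i * (f (x i) - ∫ y, f ((insert j T).piecewise y (x i)) ∂cubeMeasure d) =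
        ∫ t, ∑ i ∈ s, a i * (f (Function.update (x i) j t) -
          ∫ y, f (T.piecewise y (Function.update (x i) j t)) ∂cubeMeasure d) ∂unitMeasure +
        ∫ t, ∑ i ∈ s, (a i * kernel (x i j) t) * cubePartial j f (Function.update (x i) j t)
          ∂unitMeasure := by
      have h1 : ∀ i ∈ s, Integrable (fun t => a i * (f (Function.update (x i) j t) -
          ∫ y, f (T.piecewise y (Function.update (x i) j t)) ∂cubeMeasure d)) unitMeasure :=
        fun i _ => ((hi1 i).sub (hmean i).1).const_mul (a i)
      have h2 : ∀ i ∈ s, Integrable (fun t => a i * kernel (x i j) t *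
          cubePartial j f (Function.update (x i) j t)) unitMeasure := fun i _ => by
        simpa only [mul_assoc] using (hi2 i).const_mul (a i)
      rw [integral_finsetSum _ h1, integral_finsetSum _ h2, ← Finset.sum_add_distrib]
      refine Finset.sum_congr rfl fun i _ => ?_
      rw [hrep]
      simp only [mul_assoc, integral_const_mul]
      ring
    rw [hA, Finset.sum_powerset_insert hj, mul_add]
    refine (abs_add_le _ _).trans (add_le_add ?_ ?_)
    · have hb : ∀ᵐ t ∂unitMeasure, ‖∑ i ∈ s, a i * (f (Function.update (x i) j t) -
          ∫ y, f (T.piecewise y (Function.update (x i) j t)) ∂cubeMeasure d)‖ ≤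
          M * ∑ u ∈ T.powerset, if u = ∅ then 0 else kernelNorm s a x u := by
        filter_upwards [ae_mem_unit] with t ht
        refine (ih hfT a _ (hx' t ht) (hagree' t)).trans (le_of_eq ?_)
        congr 1
        refine Finset.sum_congr rfl fun u hu => ?_
        rw [kernelNorm_update _ _ _ fun h => hj (Finset.mem_powerset.1 hu h)]
      simpa using norm_integral_le_of_norm_le_const hb
    · have hb : ∀ᵐ t ∂unitMeasure, ‖∑ i ∈ s, (a i * kernel (x i j) t) *
          cubePartial j f (Function.update (x i) j t)‖ ≤
          M * ∑ u ∈ T.powerset, kernelNorm s (fun i => a i * kernel (x i j) t)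
            (fun i => Function.update (x i) j t) u := by
        filter_upwards [ae_mem_unit] with t ht
        rcases s.eq_empty_or_nonempty with rfl | ⟨i₀, _⟩
        · simp [kernelNorm]
        have h1 := ih hf' (fun i => a i * kernel (x i j) t) _ (hx' t ht) (hagree' t)
        -- The induction hypothesis controls `∂_j f` only up to its mean over `T`. That mean is the
        -- same constant for every point, and its contribution is the term `u = ∅`, which becomes
        -- `{j}` after integration over `t`.
        have hconst : ∀ i, ∫ y, cubePartial j f (T.piecewise y (Function.update (x i) j t))
            ∂cubeMeasure d = ∫ y, cubePartial j f (T.piecewise y (Function.update (x i₀) j t))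
            ∂cubeMeasure d := by
          intro i
          congr 1
          ext y
          congr 1
          ext m
          by_cases hm : m ∈ T
          · simp [hm]
          · simp only [Finset.piecewise_eq_of_notMem _ _ _ hm]
            exact hagree' t i i₀ m hm
        set c := ∫ y, cubePartial j f (T.piecewise y (Function.update (x i₀) j t)) ∂cubeMeasure d
          with hc
        have hcM : |c| ≤ M := by
          have := norm_integral_le_of_norm_le_const (μ := cubeMeasure d)
            (f := fun y => cubePartial j f (T.piecewise y (Function.update (x i₀) j t))) (C := M)
            ((ae_mem_cube d).mono fun y hy =>
              hf'.abs_le (piecewise_mem_cube (hx' t ht i₀) hy T))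
          simpa using this
        simp only [hconst, mul_sub, Finset.sum_sub_distrib, ← Finset.sum_mul] at h1
        have h2 : |(∑ i ∈ s, a i * kernel (x i j) t) * c| ≤
            M * kernelNorm s (fun i => a i * kernel (x i j) t)
              (fun i => Function.update (x i) j t) ∅ := by
          rw [kernelNorm_empty, abs_mul, mul_comm]
          exact mul_le_mul_of_nonneg_right hcM (abs_nonneg _)
        have h3 : ∑ u ∈ T.powerset, kernelNorm s (fun i => a i * kernel (x i j) t)
            (fun i => Function.update (x i) j t) u =
            kernelNorm s (fun i => a i * kernel (x i j) t)
              (fun i => Function.update (x i) j t) ∅ +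
            ∑ u ∈ T.powerset, if u = ∅ then 0 else kernelNorm s
              (fun i => a i * kernel (x i j) t) (fun i => Function.update (x i) j t) u := by
          have hmem := Finset.empty_mem_powerset T
          rw [← Finset.add_sum_erase _ _ hmem,
            ← Finset.add_sum_erase _ (fun u => if u = ∅ then 0 else kernelNorm s
              (fun i => a i * kernel (x i j) t) (fun i => Function.update (x i) j t) u) hmem,
            if_pos rfl, zero_add]
          congr 1
          exact Finset.sum_congr rfl fun u hu => by rw [if_neg (Finset.ne_of_mem_erase hu)]
        rw [h3, mul_add, Real.norm_eq_abs]
        have h4 := abs_add_le ((∑ i ∈ s, a i * kernel (x i j) t) * c)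
          (∑ i ∈ s, a i * kernel (x i j) t * cubePartial j f (Function.update (x i) j t) -
            (∑ i ∈ s, a i * kernel (x i j) t) * c)
        rw [add_sub_cancel] at h4
        linarith
      have hnot : ∀ u ∈ T.powerset, j ∉ u := fun u hu h => hj (Finset.mem_powerset.1 hu h)
      refine (norm_integral_le_of_norm_le (Integrable.const_mul (integrable_finsetSum _
        fun u hu => integrable_kernelNorm_insert s a x (hnot u hu)) M) hb).trans (le_of_eq ?_)
      rw [integral_const_mul, integral_finsetSum _
        fun u hu => integrable_kernelNorm_insert s a x (hnot u hu)]
      congr 1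
      refine Finset.sum_congr rfl fun u hu => ?_
      rw [integral_kernelNorm_insert s a x (hnot u hu), if_neg (Finset.insert_ne_empty j u)]

theorem sq_integral_le {α : Type*} [MeasurableSpace α] {μ : Measure α} [IsProbabilityMeasure μ]
    {h : α → ℝ} (hi : Integrable h μ) (hi2 : Integrable (fun x => h x ^ 2) μ) :
    (∫ x, h x ∂μ) ^ 2 ≤ ∫ x, h x ^ 2 ∂μ := by
  set c := ∫ x, h x ∂μ with hc
  have h0 : 0 ≤ ∫ x, (h x - c) ^ 2 ∂μ := integral_nonneg fun _ => sq_nonneg _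
  have e : ∀ x, (h x - c) ^ 2 = h x ^ 2 - (2 * c * h x - c ^ 2) := fun x => by ring
  simp only [e] at h0
  have hl : Integrable (fun x => 2 * c * h x) μ := hi.const_mul _
  have hl' : Integrable (fun x => 2 * c * h x - c ^ 2) μ := hl.sub (integrable_const _)
  rw [integral_sub hi2 hl', integral_sub hl (integrable_const _), integral_const_mul, ← hc] at h0
  simp at h0
  nlinarith

/-! ### Shifted lattice rules -/

/-- The shifted lattice rule on the unit cube. -/
def latticeRule {d : ℕ} (n : ℕ) (z : Fin d → ℕ) (f : (Fin d → ℝ) → ℝ) (Δ : Fin d → ℝ) : ℝ :=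
  (1 / (n : ℝ)) * ∑ i ∈ Finset.Icc 1 n, f (shiftedPoint n z Δ i)

theorem abs_kernelMean_le {d n : ℕ} (hn : 0 < n) (z : Fin d → ℕ) (u : Finset (Fin d))
    (Δ : Fin d → ℝ) {y : Fin d → ℝ} (hy : y ∈ Icc (0 : Fin d → ℝ) 1) :
    |kernelMean n z u Δ y| ≤ 1 := by
  have hn' : (n : ℝ) ≠ 0 := by positivity
  refine (Finset.abs_sum_le_sum_abs _ _).trans ?_
  have : ∀ i ∈ Finset.Icc 1 n,
      |1 / (n : ℝ) * ∏ j ∈ u, kernel (shiftedPoint n z Δ i j) (y j)| ≤ 1 / n := by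
    intro i _
    rw [abs_mul, abs_of_nonneg (by positivity), Finset.abs_prod]
    exact mul_le_of_le_one_right (by positivity)
      (Finset.prod_le_one (fun _ _ => abs_nonneg _) fun j _ => abs_kernel_le ⟨hy.1 j, hy.2 j⟩)
  refine (Finset.sum_le_sum this).trans (le_of_eq ?_)
  simp
  field_simp

theorem integrable_kernelMean_sq {d n : ℕ} (hn : 0 < n) (z : Fin d → ℕ) (u : Finset (Fin d)) :
    Integrable (fun p : (Fin d → ℝ) × (Fin d → ℝ) => kernelMean n z u p.1 p.2 ^ 2)
      ((cubeMeasure d).prod (cubeMeasure d)) := by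
  refine integrable_of_measurable_bound (C := 1) ((measurable_kernelMean n z u).pow_const 2) ?_
  have : ∀ᵐ p ∂(cubeMeasure d).prod (cubeMeasure d), p.2 ∈ Icc (0 : Fin d → ℝ) 1 :=
    Measure.quasiMeasurePreserving_snd.ae (ae_mem_cube d)
  filter_upwards [this] with p hp
  rw [abs_pow]
  exact pow_le_one₀ (abs_nonneg _) (abs_kernelMean_le hn z u p.1 hp)

theorem abs_latticeRule_error_le {d n : ℕ} (hn : 0 < n) (z : Fin d → ℕ) {M : ℝ}
    {f : (Fin d → ℝ) → ℝ} (hf : BoundedDerivs d M f) (Δ : Fin d → ℝ) :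
    |(∫ y, f y ∂cubeMeasure d) - latticeRule n z f Δ| ≤
      M * ∑ u : Finset (Fin d), if u = ∅ then 0 else
        ∫ y, |kernelMean n z u Δ y| ∂cubeMeasure d := by
  have hn' : (n : ℝ) ≠ 0 := by positivity
  have hcard : (Finset.univ : Finset (Fin d)).card = d := by simp
  have h := abs_sum_sub_mean_le (M := M) (Finset.Icc 1 n) (Finset.univ : Finset (Fin d)) (f := f)
    (by rwa [hcard]) (fun _ => 1 / (n : ℝ)) (fun i => shiftedPoint n z Δ i)
    (fun i => shiftedPoint_mem n z Δ i) (fun _ _ j hj => absurd (Finset.mem_univ j) hj)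
  rw [Finset.powerset_univ] at h
  refine le_trans (le_of_eq ?_) h
  simp only [Finset.piecewise_univ]
  rw [← Finset.mul_sum, Finset.sum_sub_distrib, Finset.sum_const, Nat.card_Icc,
    Nat.add_sub_cancel, nsmul_eq_mul, latticeRule, abs_sub_comm, mul_sub]
  congr 2
  field_simp

theorem sq_integral_abs_kernelMean_le {d n : ℕ} (hn : 0 < n) (z : Fin d → ℕ)
    (u : Finset (Fin d)) (Δ : Fin d → ℝ) :
    (∫ y, |kernelMean n z u Δ y| ∂cubeMeasure d) ^ 2 ≤
      ∫ y, kernelMean n z u Δ y ^ 2 ∂cubeMeasure d := by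
  have hm : Measurable (kernelMean n z u Δ) :=
    Measurable.of_uncurry_left (f := kernelMean n z u) (measurable_kernelMean n z u)
  have hb : ∀ᵐ y ∂cubeMeasure d, |kernelMean n z u Δ y| ≤ 1 :=
    (ae_mem_cube d).mono fun y hy => abs_kernelMean_le hn z u Δ hy
  have hi : Integrable (fun y => |kernelMean n z u Δ y|) (cubeMeasure d) :=
    Integrable.abs (integrable_of_measurable_bound hm hb)
  have hi2 : Integrable (fun y => |kernelMean n z u Δ y| ^ 2) (cubeMeasure d) := by
    refine integrable_of_measurable_bound (C := 1) (hm.abs.pow_const 2) ?_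
    filter_upwards [hb] with y hy
    rw [abs_pow, abs_abs]
    exact pow_le_one₀ (abs_nonneg _) hy
  have h := sq_integral_le hi hi2
  simpa only [sq_abs] using h

/-- Cauchy–Schwarz over the `2 ^ d` coordinate sets, then Jensen in `y`, passes to the `L²`
quantities that can be computed after averaging over the shift. -/
theorem latticeRule_error_sq_le {d n : ℕ} (hn : 0 < n) (z : Fin d → ℕ) {M : ℝ}
    {f : (Fin d → ℝ) → ℝ} (hf : BoundedDerivs d M f) (Δ : Fin d → ℝ) :
    ((∫ y, f y ∂cubeMeasure d) - latticeRule n z f Δ) ^ 2 ≤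
      M ^ 2 * (2 ^ d * ∑ u : Finset (Fin d), if u = ∅ then 0 else
        ∫ y, kernelMean n z u Δ y ^ 2 ∂cubeMeasure d) := by
  have h1 := pow_le_pow_left₀ (abs_nonneg _) (abs_latticeRule_error_le hn z hf Δ) 2
  rw [sq_abs, mul_pow] at h1
  refine h1.trans (mul_le_mul_of_nonneg_left ?_ (sq_nonneg _))
  have h2 := sq_sum_le_card_mul_sum_sq (s := (Finset.univ : Finset (Finset (Fin d))))
    (f := fun u => if u = ∅ then (0 : ℝ) else ∫ y, |kernelMean n z u Δ y| ∂cubeMeasure d)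
  have hcard : ((Finset.univ : Finset (Finset (Fin d))).card : ℝ) = 2 ^ d := by
    rw [Finset.card_univ, Fintype.card_finset, Fintype.card_fin, Nat.cast_pow, Nat.cast_ofNat]
  rw [hcard] at h2
  refine h2.trans (mul_le_mul_of_nonneg_left (Finset.sum_le_sum fun u _ => ?_) (pow_nonneg zero_le_two d))
  by_cases hu : u = ∅
  · rw [if_pos hu, if_pos hu, zero_pow two_ne_zero]
  · rw [if_neg hu, if_neg hu]
    exact sq_integral_abs_kernelMean_le hn z u Δ

/-- The shift-averaged squared error of a lattice rule with a CBC generating vector. -/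
theorem exists_integral_latticeRule_error_sq_le {d : ℕ} {γ : Finset (Fin d) → ℝ}
    (hγ : ∀ u, 0 < γ u) :
    ∃ C : ℝ, 0 ≤ C ∧ ∀ (ℓ : ℕ) (z : Fin d → ℕ), IsCBCVector (2 ^ ℓ) γ z →
      ∀ (M : ℝ) (f : (Fin d → ℝ) → ℝ), BoundedDerivs d M f →
        ∫ Δ, ((∫ y, f y ∂cubeMeasure d) - latticeRule (2 ^ ℓ) z f Δ) ^ 2 ∂cubeMeasure d ≤
          M ^ 2 * (C / 2 ^ ℓ) := by
  have hs : 0 ≤ ∑ v, γ v := Finset.sum_nonneg fun v _ => (hγ v).le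
  have hterm : ∀ u, 0 ≤ 1 + (∑ v, γ v) / γ u := fun u => by
    have := div_nonneg hs (hγ u).le
    linarith
  refine ⟨2 ^ d * ∑ u, (1 + (∑ v, γ v) / γ u),
    mul_nonneg (by positivity) (Finset.sum_nonneg fun u _ => hterm u), ?_⟩
  intro ℓ z hz M f hf
  have hn : 0 < 2 ^ ℓ := by positivity
  have hint : ∀ u : Finset (Fin d), Integrable (fun Δ => if u = ∅ then (0 : ℝ) else
        ∫ y, kernelMean (2 ^ ℓ) z u Δ y ^ 2 ∂cubeMeasure d) (cubeMeasure d) := by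
    intro u
    by_cases hu : u = ∅
    · simp [hu]
    · simpa only [if_neg hu] using (integrable_kernelMean_sq hn z u).integral_prod_left
  refine (integral_mono_of_nonneg (Filter.Eventually.of_forall fun _ => sq_nonneg _)
    (((integrable_finsetSum _ fun u _ => hint u).const_mul _).const_mul _)
    (Filter.Eventually.of_forall fun Δ => latticeRule_error_sq_le hn z hf Δ)).trans ?_
  rw [integral_const_mul, integral_const_mul, integral_finsetSum _ fun u _ => hint u, mul_div_assoc,
    Finset.sum_div]
  refine mul_le_mul_of_nonneg_left (mul_le_mul_of_nonneg_left (Finset.sum_le_sum fun u _ => ?_)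
    (by positivity)) (sq_nonneg _)
  by_cases hu : u = ∅
  · simp only [if_pos hu, integral_zero]
    exact div_nonneg (hterm u) (by positivity)
  · simp only [if_neg hu]
    rw [← integral_prod _ (integrable_kernelMean_sq hn z u), integral_kernelMean_sq hn]
    exact latticeMean_le_of_isCBCVector hγ (fun n z u hn => latticeMean_nonneg hn z u) hz
      (Finset.nonempty_iff_ne_empty.2 hu)

/-! ### Symmetry of iterated derivatives -/

section Symmetry

variable {E F : Type*} [NormedAddCommGroup E] [NormedSpace ℝ E] [NormedAddCommGroup F]
  [NormedSpace ℝ F] {S : Set E} {f : E → F}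

theorem infty_add_natCast_le (n : ℕ) : (∞ : WithTop ℕ∞) + n ≤ ∞ := by
  exact_mod_cast (le_top : (⊤ : ℕ∞) + n ≤ ⊤)

theorem contDiffOn_iteratedFDerivWithin_infty (hS : UniqueDiffOn ℝ S)
    (hf : ContDiffOn ℝ ∞ f S) (n : ℕ) : ContDiffOn ℝ ∞ (iteratedFDerivWithin ℝ n f S) S :=
  fun x hx => (hf x hx).iteratedFDerivWithin_right hS (infty_add_natCast_le n) hx

theorem fderivWithin_clm_comp (hS : UniqueDiffOn ℝ S) {H : Type*} [NormedAddCommGroup H]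
    [NormedSpace ℝ H] (L : F →L[ℝ] H) (hf : ContDiffOn ℝ ∞ f S) {x : E} (hx : x ∈ S) (v : E) :
    fderivWithin ℝ (fun y => L (f y)) S x v = L (fderivWithin ℝ f S x v) := by
  have hd : DifferentiableWithinAt ℝ f S x := (hf x hx).differentiableWithinAt (by simp)
  exact congrArg (fun A : E →L[ℝ] H => A v)
    ((L.hasFDerivAt.comp_hasFDerivWithinAt x hd.hasFDerivWithinAt).fderivWithin (hS x hx))

theorem iteratedFDerivWithin_succ_apply_eq_fderivWithin (hS : UniqueDiffOn ℝ S)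
    (hf : ContDiffOn ℝ ∞ f S) (n : ℕ) {x : E} (hx : x ∈ S) (w : Fin (n + 1) → E) :
    iteratedFDerivWithin ℝ (n + 1) f S x w =
      fderivWithin ℝ (fun y => iteratedFDerivWithin ℝ n f S y (Fin.tail w)) S x (w 0) := by
  rw [iteratedFDerivWithin_succ_apply_left]
  exact (fderivWithin_clm_comp hS (ContinuousMultilinearMap.apply ℝ (fun _ : Fin n => E) F
    (Fin.tail w)) (contDiffOn_iteratedFDerivWithin_infty hS hf n) hx (w 0)).symm

theorem iteratedFDerivWithin_add_two_apply (hS : UniqueDiffOn ℝ S) (hf : ContDiffOn ℝ ∞ f S)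
    (n : ℕ) {x : E} (hx : x ∈ S) (v : Fin (n + 2) → E) :
    iteratedFDerivWithin ℝ (n + 2) f S x v =
      fderivWithin ℝ (fderivWithin ℝ (iteratedFDerivWithin ℝ n f S) S) S x (v 0) (v 1)
        (Fin.tail (Fin.tail v)) := by
  rw [iteratedFDerivWithin_succ_apply_eq_fderivWithin hS hf _ hx]
  simp only [iteratedFDerivWithin_succ_apply_left]
  exact fderivWithin_clm_comp hS ((ContinuousMultilinearMap.apply ℝ (fun _ : Fin n => E) F
    (Fin.tail (Fin.tail v))).comp (ContinuousLinearMap.apply ℝ _ (v 1)))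
    ((contDiffOn_iteratedFDerivWithin_infty hS hf n).fderivWithin hS (by simp)) hx (v 0)

/-- Swapping the first two slots is symmetry of the second derivative of the `n`-th derivative; any
later swap acts inside the tail, where induction applies. The closure condition gives symmetry at
boundary points too. -/
theorem iteratedFDerivWithin_comp_swap (hS : UniqueDiffOn ℝ S) (hcl : S ⊆ closure (interior S))
    (hf : ContDiffOn ℝ ∞ f S) (n : ℕ) :
    ∀ (i : Fin n) {x : E} (_ : x ∈ S) (v : Fin (n + 1) → E),
      iteratedFDerivWithin ℝ (n + 1) f S x (v ∘ Equiv.swap i.castSucc i.succ) =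
        iteratedFDerivWithin ℝ (n + 1) f S x v := by
  induction n with
  | zero => exact fun i => i.elim0
  | succ n ih =>
    intro i x hx v
    refine Fin.cases ?_ (fun i => ?_) i
    · have hsymm : IsSymmSndFDerivWithinAt ℝ (iteratedFDerivWithin ℝ n f S) S x :=
        (contDiffOn_iteratedFDerivWithin_infty hS hf n x hx).isSymmSndFDerivWithinAt
          (by rw [minSmoothness_of_isRCLikeNormedField]; exact WithTop.coe_le_coe.2 (le_top : (2 : ℕ∞) ≤ ⊤)) hS (hcl hx) hx
      rw [iteratedFDerivWithin_add_two_apply hS hf n hx, iteratedFDerivWithin_add_two_apply hS hf n hx]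
      have h0 : (v ∘ Equiv.swap (Fin.castSucc (0 : Fin (n + 1))) (Fin.succ 0)) 0 = v 1 := by simp
      have h1 : (v ∘ Equiv.swap (Fin.castSucc (0 : Fin (n + 1))) (Fin.succ 0)) 1 = v 0 := by simp
      have h2 : Fin.tail (Fin.tail (v ∘ Equiv.swap (Fin.castSucc (0 : Fin (n + 1))) (Fin.succ 0))) =
          Fin.tail (Fin.tail v) := by
        ext m
        simp only [Fin.tail, Function.comp_apply]
        rw [Equiv.swap_apply_of_ne_of_ne]
        · simp [Fin.ext_iff]
        · simp [Fin.ext_iff]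
      rw [h0, h1, h2, hsymm.eq]
    · have h0 : (v ∘ Equiv.swap i.succ.castSucc i.succ.succ) 0 = v 0 := by
        rw [Function.comp_apply, Equiv.swap_apply_of_ne_of_ne]
        · simp [Fin.ext_iff]
        · simp [Fin.ext_iff]
      have h1 : Fin.tail (v ∘ Equiv.swap i.succ.castSucc i.succ.succ) =
          Fin.tail v ∘ Equiv.swap i.castSucc i.succ := by
        ext m
        simp only [Fin.tail, Function.comp_apply, ← Fin.succ_castSucc]
        rw [(Fin.succ_injective _).swap_apply]
      rw [iteratedFDerivWithin_succ_apply_eq_fderivWithin hS hf _ hx,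
        iteratedFDerivWithin_succ_apply_eq_fderivWithin hS hf _ hx, h0, h1]
      congr 1
      refine fderivWithin_congr (fun y hy => ih i hy _) (ih i hx _)

theorem iteratedFDerivWithin_comp_perm (hS : UniqueDiffOn ℝ S) (hcl : S ⊆ closure (interior S))
    (hf : ContDiffOn ℝ ∞ f S) {n : ℕ} {x : E} (hx : x ∈ S) (σ : Equiv.Perm (Fin n)) :
    ∀ v : Fin n → E, iteratedFDerivWithin ℝ n f S x (v ∘ σ) = iteratedFDerivWithin ℝ n f S x v := by
  cases n with
  | zero => intro v; congr 1; exact Subsingleton.elim _ _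
  | succ n =>
    induction σ using Submonoid.dense_induction _ (Equiv.Perm.mclosure_swap_castSucc_succ n) with
    | mem σ h =>
      obtain ⟨i, rfl⟩ := h
      exact iteratedFDerivWithin_comp_swap hS hcl hf n i hx
    | one => intro v; rfl
    | mul σ τ h1 h2 =>
      intro v
      rw [Equiv.Perm.coe_mul, ← Function.comp_assoc, h2, h1]

end Symmetry

/-! ### Operator norms of derivatives from mixed partial derivatives -/

/-- A multilinear map on `ℝ^d` is bounded in terms of its values on the coordinate directions. -/
theorem norm_multilinear_le_of_basis {d i : ℕ} {F : Type*} [NormedAddCommGroup F] [NormedSpace ℝ F]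
    (T : ContinuousMultilinearMap ℝ (fun _ : Fin i => Fin d → ℝ) F) {B : ℝ} (hB : 0 ≤ B)
    (h : ∀ r : Fin i → Fin d, ‖T fun a => Pi.single (r a) (1 : ℝ)‖ ≤ B) : ‖T‖ ≤ d ^ i * B := by
  refine T.opNorm_le_bound (by positivity) fun v => ?_
  have hv : v = fun a => ∑ j, v a j • (Pi.single j (1 : ℝ) : Fin d → ℝ) :=
    funext fun a => pi_eq_sum_univ' (v a)
  have hT : T v = ∑ r : Fin i → Fin d, (∏ a, v a (r a)) • T fun a => Pi.single (r a) (1 : ℝ) := by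
    conv_lhs => rw [hv]
    rw [T.map_sum]
    exact Finset.sum_congr rfl fun r _ => T.map_smul_univ (fun a => v a (r a)) _
  rw [hT]
  refine (norm_sum_le _ _).trans ?_
  have : ∀ r ∈ (Finset.univ : Finset (Fin i → Fin d)),
      ‖(∏ a, v a (r a)) • T fun a => Pi.single (r a) (1 : ℝ)‖ ≤ (∏ a, ‖v a‖) * B := by
    intro r _
    rw [norm_smul, norm_prod]
    gcongr with a
    · exact norm_le_pi_norm (v a) (r a)
    · exact h r
  refine (Finset.sum_le_sum this).trans (le_of_eq ?_)
  rw [Finset.sum_const, Finset.card_univ, Fintype.card_fun, Fintype.card_fin, Fintype.card_fin,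
    nsmul_eq_mul]
  push_cast
  ring

theorem convex_paramBox (s : ℕ) : Convex ℝ (paramBox s) := convex_Icc _ _

theorem uniqueDiffOn_paramBox (s : ℕ) : UniqueDiffOn ℝ (paramBox s) :=
  uniqueDiffOn_Icc_pi fun _ => by norm_num

theorem paramBox_subset_closure_interior (s : ℕ) :
    paramBox s ⊆ closure (interior (paramBox s)) := by
  have hne : (interior (paramBox s)).Nonempty := by
    rw [paramBox, ← pi_univ_Icc, interior_pi_set finite_univ, univ_pi_nonempty_iff]
    intro i
    rw [interior_Icc]
    exact ⟨0, by norm_num, by norm_num⟩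
  rw [(convex_paramBox s).closure_interior_eq_closure_of_nonempty_interior hne]
  exact subset_closure

/-- Directional derivatives along arbitrary lists of coordinates are mixed partial derivatives. -/
theorem exists_partialDerivWithin_eq {s i : ℕ} {F : Type*} [NormedAddCommGroup F] [NormedSpace ℝ F]
    {f : (Fin s → ℝ) → F} (hf : ContDiffOn ℝ ∞ f (paramBox s)) {x : Fin s → ℝ}
    (hx : x ∈ paramBox s) (r : Fin i → Fin s) :
    ∃ ν : Fin s → ℕ, ∑ j, ν j = i ∧
      partialDerivWithin ν f (paramBox s) x =
        iteratedFDerivWithin ℝ i f (paramBox s) x fun a => Pi.single (r a) (1 : ℝ) := by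
  -- The multi-index counts how often each direction occurs in `r`, and `e₀` enumerates the
  -- positions fibre by fibre, which sorts the list.
  let ν : Fin s → ℕ := fun j => Fintype.card {a // r a = j}
  let e₀ : (Σ j, Fin (ν j)) ≃ Fin i :=
    (Equiv.sigmaCongrRight fun j => (Fintype.equivFin {a // r a = j}).symm).trans
      (Equiv.sigmaFiberEquiv r)
  have he₀ : ∀ p, r (e₀ p) = p.1 := fun p => ((Fintype.equivFin {a // r a = p.1}).symm p.2).2
  have hi : ∑ j, ν j = i := by
    have := Fintype.card_congr (finSigmaFinEquiv.symm.trans e₀)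
    simpa using this
  refine ⟨ν, hi, ?_⟩
  clear_value e₀ ν
  subst hi
  let σ : Equiv.Perm (Fin (∑ j, ν j)) := finSigmaFinEquiv.symm.trans e₀
  rw [← iteratedFDerivWithin_comp_perm (uniqueDiffOn_paramBox s)
    (paramBox_subset_closure_interior s) hf hx σ, partialDerivWithin]
  congr 1
  ext1 a
  simp only [Function.comp_apply, σ, Equiv.trans_apply, he₀]

/-! ### Families of functions with uniformly bounded derivatives -/

section UniformlySmooth

variable {ι E F H : Type*} [NormedAddCommGroup E] [NormedSpace ℝ E] [NormedAddCommGroup F]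
  [NormedSpace ℝ F] [NormedAddCommGroup H] [NormedSpace ℝ H]

/-- The functions `f a` are smooth on `S`, and each order of derivatives is bounded uniformly
in `a`. -/
def UniformlySmooth (S : Set E) (f : ι → E → F) : Prop :=
  (∀ a, ContDiffOn ℝ ∞ (f a) S) ∧
    ∀ i : ℕ, ∃ M : ℝ, ∀ a, ∀ x ∈ S, ‖iteratedFDerivWithin ℝ i (f a) S x‖ ≤ M

theorem UniformlySmooth.exists_bound {S : Set E} {f : ι → E → F} (hf : UniformlySmooth S f)
    (N : ℕ) : ∃ M : ℝ, 1 ≤ M ∧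
      ∀ a, ∀ i ≤ N, ∀ x ∈ S, ‖iteratedFDerivWithin ℝ i (f a) S x‖ ≤ M := by
  choose M hM using hf.2
  refine ⟨1 + ∑ i ∈ Finset.range (N + 1), |M i|,
    le_add_of_nonneg_right (Finset.sum_nonneg fun _ _ => abs_nonneg _), fun a i hi x hx => ?_⟩
  have h1 := Finset.single_le_sum (f := fun i => |M i|) (fun i _ => abs_nonneg _)
    (Finset.mem_range.2 (Nat.lt_succ_of_le hi))
  have h2 := le_abs_self (M i)
  have h3 := hM i a x hx
  linarith

theorem UniformlySmooth.reindex {κ : Type*} {S : Set E} {f : ι → E → F}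
    (hf : UniformlySmooth S f) (σ : κ → ι) : UniformlySmooth S fun b => f (σ b) :=
  ⟨fun b => hf.1 (σ b), fun i => (hf.2 i).imp fun _ h b => h (σ b)⟩

theorem UniformlySmooth.congr {S : Set E} {f f' : ι → E → F} (hf : UniformlySmooth S f)
    (h : ∀ a, EqOn (f' a) (f a) S) : UniformlySmooth S f' := by
  refine ⟨fun a => (hf.1 a).congr (h a), fun i => (hf.2 i).imp fun M hM a x hx => ?_⟩
  rw [iteratedFDerivWithin_congr (h a) hx]
  exact hM a x hx

theorem UniformlySmooth.comp {S : Set E} {T : Set F} {f : ι → E → F} {g : ι → F → H}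
    (hg : UniformlySmooth T g) (hf : UniformlySmooth S f) (hS : UniqueDiffOn ℝ S)
    (hT : UniqueDiffOn ℝ T) (hmaps : ∀ a, MapsTo (f a) S T) :
    UniformlySmooth S fun a x => g a (f a x) := by
  refine ⟨fun a => (hg.1 a).comp (hf.1 a) (hmaps a), fun i => ?_⟩
  obtain ⟨C, hC1, hC⟩ := hg.exists_bound i
  obtain ⟨D, hD1, hD⟩ := hf.exists_bound i
  -- The Faà di Bruno bound asks for `D ^ j` on derivatives of order `j ≥ 1`; since `D ≥ 1`, the
  -- common bound `D` suffices.
  refine ⟨i.factorial * C * D ^ i, fun a x hx => ?_⟩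
  exact norm_iteratedFDerivWithin_comp_le (hg.1 a) (hf.1 a) (by exact_mod_cast le_top) hT hS
    (hmaps a) hx (fun j hj => hC a j hj _ (hmaps a hx))
    fun j hj1 hj => (hD a j hj x hx).trans (le_self_pow₀ hD1 (by omega))

theorem uniformlySmooth_affine {S : Set E} (hS : UniqueDiffOn ℝ S) {B : ℝ}
    (hB : ∀ x ∈ S, ‖x‖ ≤ B) (L : E →L[ℝ] F) {c : ι → F} {R : ℝ} (hc : ∀ a, ‖c a‖ ≤ R) :
    UniformlySmooth S fun a x => c a + L x := by
  refine ⟨fun a => (contDiff_const.add L.contDiff).contDiffOn, fun i => ?_⟩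
  cases i with
  | zero =>
    refine ⟨R + ‖L‖ * B, fun a x hx => ?_⟩
    rw [norm_iteratedFDerivWithin_zero]
    exact (norm_add_le _ _).trans (add_le_add (hc a)
      ((L.le_opNorm x).trans (mul_le_mul_of_nonneg_left (hB x hx) (norm_nonneg _))))
  | succ i =>
    refine ⟨‖L‖, fun a x hx => ?_⟩
    have hd : EqOn (fderivWithin ℝ (fun x => c a + L x) S) (fun _ => L) S := fun y hy => by
      rw [fderivWithin_const_add]
      exact L.fderivWithin (hS y hy)
    rw [← norm_iteratedFDerivWithin_fderivWithin hS hx, iteratedFDerivWithin_congr hd hx]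
    cases i with
    | zero => rw [norm_iteratedFDerivWithin_zero]
    | succ i => simp [iteratedFDerivWithin_const_of_ne (Nat.succ_ne_zero i)]

theorem uniformlySmooth_const_of_isCompact {S : Set E} (hS : UniqueDiffOn ℝ S) (hc : IsCompact S)
    {g : E → F} (hg : ContDiffOn ℝ ∞ g S) : UniformlySmooth S fun _ : ι => g := by
  refine ⟨fun _ => hg, fun i => ?_⟩
  obtain ⟨M, hM⟩ := hc.exists_bound_of_continuousOn
    (hg.continuousOn_iteratedFDerivWithin (m := i) (by exact_mod_cast le_top) hS)
  exact ⟨M, fun _ => hM⟩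

/-- The weights are nonnegative with sum at most 1, so the bound is independent of the number of
points. Indexing by all sequences covers every shift and generating vector at once. -/
theorem UniformlySmooth.average {S : Set E} (hS : UniqueDiffOn ℝ S) {f : ι → E → ℝ}
    (hf : UniformlySmooth S f) :
    UniformlySmooth S fun (a : ℕ × (ℕ → ι)) x =>
      ∑ i ∈ Finset.Icc 1 a.1, (1 / (a.1 : ℝ)) • f (a.2 i) x := by
  refine ⟨fun a => ContDiffOn.sum fun i _ => (hf.1 (a.2 i)).const_smul _, fun m => ?_⟩
  obtain ⟨M, hM1, hM⟩ := hf.exists_bound m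
  refine ⟨M, fun a x hx => ?_⟩
  have hcd : ∀ i, ContDiffWithinAt ℝ m (f (a.2 i)) S x := fun i =>
    (hf.1 (a.2 i) x hx).of_le (by exact_mod_cast le_top)
  rw [iteratedFDerivWithin_fun_sum_apply hS hx fun i _ => (hcd i).const_smul _]
  refine (norm_sum_le _ _).trans ?_
  have : ∀ i ∈ Finset.Icc 1 a.1,
      ‖iteratedFDerivWithin ℝ m (fun x => (1 / (a.1 : ℝ)) • f (a.2 i) x) S x‖ ≤
        1 / (a.1 : ℝ) * M := by
    intro i _
    change ‖iteratedFDerivWithin ℝ m ((1 / (a.1 : ℝ)) • f (a.2 i)) S x‖ ≤ _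
    rw [iteratedFDerivWithin_const_smul_apply (hcd i) hS hx, norm_smul, Real.norm_of_nonneg
      (by positivity)]
    exact mul_le_mul_of_nonneg_left (hM _ _ le_rfl x hx) (by positivity)
  refine (Finset.sum_le_sum this).trans ?_
  rw [Finset.sum_const, Nat.card_Icc, Nat.add_sub_cancel, nsmul_eq_mul, ← mul_assoc]
  refine mul_le_of_le_one_left (by linarith) ?_
  rw [mul_one_div]
  exact div_self_le_one _

theorem UniformlySmooth.exists_boundedDerivs {d : ℕ} {f : ι → (Fin d → ℝ) → ℝ}
    (hf : UniformlySmooth (Icc 0 1) f) (N : ℕ) : ∃ M : ℝ, ∀ a, BoundedDerivs N M (f a) := by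
  obtain ⟨M, -, hM⟩ := hf.exists_bound N
  exact ⟨M, fun a => ⟨hf.1 a, hM a⟩⟩

end UniformlySmooth

/-! ### Gevrey-regular forward models -/

theorem GevreyRegular.uniformlySmooth {k : ℕ} {Ξ : Type*} {C β : ℝ} {b : ℕ → ℝ}
    {G : (s : ℕ) → (Fin s → ℝ) → Ξ → EuclideanSpace ℝ (Fin k)} (hC : 0 ≤ C) (hb : ∀ j, 0 ≤ b j)
    (hG : GevreyRegular C β b G) {s : ℕ} (hs : 1 ≤ s) :
    UniformlySmooth (paramBox s) fun ξ θ => G s θ ξ := by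
  refine ⟨fun ξ => (hG s hs ξ).1, fun i => ?_⟩
  -- Raising each factor to at least 1 bounds `b^ν` by `P ^ i` for every `ν` of order `i`.
  set P : ℝ := ∏ j : Fin s, max 1 (b j) with hP
  have hB : 0 ≤ C * (i.factorial : ℝ) ^ β * P ^ i := by
    have : 0 ≤ P := Finset.prod_nonneg fun j _ => zero_le_one.trans (le_max_left _ _)
    positivity
  refine ⟨s ^ i * (C * (i.factorial : ℝ) ^ β * P ^ i), fun ξ θ hθ => ?_⟩
  refine norm_multilinear_le_of_basis _ hB fun r => ?_
  obtain ⟨ν, hν, he⟩ := exists_partialDerivWithin_eq (hG s hs ξ).1 hθ r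
  rw [← he]
  refine ((hG s hs ξ).2 θ hθ ν).trans ?_
  rw [hν]
  refine mul_le_mul_of_nonneg_left ?_ (by positivity)
  rw [hP, ← Finset.prod_pow]
  refine Finset.prod_le_prod (fun j _ => pow_nonneg (hb j) _) fun j _ => ?_
  have hνi : ν j ≤ i := hν ▸ Finset.single_le_sum (fun _ _ => Nat.zero_le _) (Finset.mem_univ j)
  exact (pow_le_pow_left₀ (hb j) (le_max_right _ _) _).trans
    (pow_le_pow_right₀ (le_max_left _ _) hνi)

/-! ### The likelihood -/

/-- The Gaussian density as a function of the misfit. -/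
def gaussianDensity {k : ℕ} (Γ : Matrix (Fin k) (Fin k) ℝ) (v : Fin k → ℝ) : ℝ :=
  normConst Γ * Real.exp (-(1 / 2) * weightedNorm Γ v ^ 2)

theorem weightedNorm_sq {k : ℕ} {Γ : Matrix (Fin k) (Fin k) ℝ} (hΓ : Γ.PosDef) (v : Fin k → ℝ) :
    weightedNorm Γ v ^ 2 = v ⬝ᵥ (Γ⁻¹ *ᵥ v) := by
  refine Real.sq_sqrt ?_
  have := hΓ.inv.posSemidef.dotProduct_mulVec_nonneg v
  simpa using this

theorem contDiff_gaussianDensity {k : ℕ} {Γ : Matrix (Fin k) (Fin k) ℝ} (hΓ : Γ.PosDef) :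
    ContDiff ℝ ∞ (gaussianDensity Γ) := by
  have : gaussianDensity Γ = fun v => normConst Γ *
      Real.exp (-(1 / 2) * ∑ i, v i * ∑ j, Γ⁻¹ i j * v j) := by
    ext v
    rw [gaussianDensity, weightedNorm_sq hΓ]
    rfl
  rw [this]
  fun_prop

theorem normConst_pos {k : ℕ} {Γ : Matrix (Fin k) (Fin k) ℝ} (hΓ : Γ.PosDef) :
    0 < normConst Γ := by
  have h : 0 < ((2 * Real.pi) • Γ).det := by
    rw [Matrix.det_smul]
    have := hΓ.det_pos
    positivity
  exact one_div_pos.2 (Real.sqrt_pos.2 h)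

theorem gaussianDensity_pos {k : ℕ} {Γ : Matrix (Fin k) (Fin k) ℝ} (hΓ : Γ.PosDef)
    (v : Fin k → ℝ) : 0 < gaussianDensity Γ v :=
  mul_pos (normConst_pos hΓ) (Real.exp_pos _)

theorem exists_gaussianDensity_bounds {k : ℕ} {Γ : Matrix (Fin k) (Fin k) ℝ} (hΓ : Γ.PosDef)
    (R : ℝ) : ∃ c C : ℝ, 0 < c ∧ c < C ∧
      ∀ v ∈ Metric.closedBall (0 : Fin k → ℝ) R, gaussianDensity Γ v ∈ Icc c C := by
  rcases (Metric.closedBall (0 : Fin k → ℝ) R).eq_empty_or_nonempty with h | h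
  · exact ⟨1, 2, one_pos, one_lt_two, by simp [h]⟩
  have hcont := (contDiff_gaussianDensity hΓ).continuous.continuousOn
    (s := Metric.closedBall (0 : Fin k → ℝ) R)
  have hcpt := isCompact_closedBall (0 : Fin k → ℝ) R
  obtain ⟨v₀, -, h₀⟩ := hcpt.exists_isMinOn h hcont
  obtain ⟨v₁, -, h₁⟩ := hcpt.exists_isMaxOn h hcont
  -- Adding the positive minimum to the maximum makes the interval nondegenerate, as unique
  -- differentiability on it requires.
  refine ⟨gaussianDensity Γ v₀, gaussianDensity Γ v₀ + gaussianDensity Γ v₁,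
    gaussianDensity_pos hΓ v₀, by linarith [gaussianDensity_pos hΓ v₁], fun v hv => ⟨h₀ hv, ?_⟩⟩
  have h2 : gaussianDensity Γ v ≤ gaussianDensity Γ v₁ := h₁ hv
  linarith [gaussianDensity_pos hΓ v₀]

theorem uniqueDiffOn_closedBall {E : Type*} [NormedAddCommGroup E] [NormedSpace ℝ E] {R : ℝ}
    (hR : 0 < R) : UniqueDiffOn ℝ (Metric.closedBall (0 : E) R) :=
  uniqueDiffOn_convex (convex_closedBall _ _)
    ⟨0, Metric.ball_subset_interior_closedBall (Metric.mem_ball_self hR)⟩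

theorem mem_paramBox_of_mem_cube {s : ℕ} {x : Fin s → ℝ} (hx : x ∈ Icc (0 : Fin s → ℝ) 1) :
    (fun j => x j - 1 / 2) ∈ paramBox s := by
  refine ⟨fun j => ?_, fun j => ?_⟩
  · have h0 : (0 : ℝ) ≤ x j := hx.1 j
    change -(1 / 2 : ℝ) ≤ x j - 1 / 2
    linarith
  · have h1 : x j ≤ 1 := hx.2 j
    change x j - 1 / 2 ≤ (1 / 2 : ℝ)
    linarith

/-- The data point in `[-K, K]^k` that corresponds to `t ∈ [0, 1]^k`. -/
def dataPoint {k : ℕ} (K : ℝ) (t : Fin k → ℝ) : Fin k → ℝ := fun i => 2 * K * t i - K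

theorem norm_le_one_of_mem_cube {d : ℕ} {x : Fin d → ℝ} (hx : x ∈ Icc (0 : Fin d → ℝ) 1) :
    ‖x‖ ≤ 1 := by
  refine (pi_norm_le_iff_of_nonneg zero_le_one).2 fun j => ?_
  rw [Real.norm_eq_abs, abs_le]
  have h0 : (0 : ℝ) ≤ x j := hx.1 j
  have h1 : x j ≤ 1 := hx.2 j
  constructor <;> linarith

theorem norm_dataPoint_le {k : ℕ} {K : ℝ} (hK : 0 ≤ K) {t : Fin k → ℝ}
    (ht : t ∈ Icc (0 : Fin k → ℝ) 1) : ‖dataPoint K t‖ ≤ K := by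
  refine (pi_norm_le_iff_of_nonneg hK).2 fun j => ?_
  have h0 : (0 : ℝ) ≤ t j := ht.1 j
  have h1 : t j ≤ 1 := ht.2 j
  rw [Real.norm_eq_abs, abs_le, dataPoint]
  constructor <;> nlinarith

theorem norm_misfit_le {k : ℕ} {K R : ℝ} {y : Fin k → ℝ} (hy : ‖y‖ ≤ K)
    {m : EuclideanSpace ℝ (Fin k)} (hm : ‖m‖ ≤ R) :
    (fun i => y i - m i) ∈ Metric.closedBall (0 : Fin k → ℝ) (K + R) := by
  rw [mem_closedBall_zero_iff]
  have hKR : 0 ≤ K + R := add_nonneg ((norm_nonneg _).trans hy) ((norm_nonneg _).trans hm)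
  refine (pi_norm_le_iff_of_nonneg hKR).2 fun i => ?_
  exact (norm_sub_le _ _).trans (add_le_add ((norm_le_pi_norm y i).trans hy)
    ((PiLp.norm_apply_le m i).trans hm))

/-- The likelihood as a function of the parameters, uniformly in data and designs. -/
theorem uniformlySmooth_likelihood {ι : Type*} {s k : ℕ} {Γ : Matrix (Fin k) (Fin k) ℝ}
    (hΓ : Γ.PosDef) {K R : ℝ} (hK : 0 < K) (hR : 0 < R)
    {F : ι → (Fin s → ℝ) → EuclideanSpace ℝ (Fin k)} (hF : UniformlySmooth (paramBox s) F)
    (hFR : ∀ a, ∀ θ ∈ paramBox s, ‖F a θ‖ ≤ R) :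
    UniformlySmooth (Icc (0 : Fin s → ℝ) 1) fun (p : ι × Icc (0 : Fin k → ℝ) 1) x =>
      likelihood Γ (F p.1 fun j => x j - 1 / 2) (dataPoint K p.2.1) := by
  have hmaps₁ : MapsTo (fun (x : Fin s → ℝ) j => x j - 1 / 2) (Icc 0 1) (paramBox s) :=
    fun x hx => mem_paramBox_of_mem_cube hx
  have h₁ : UniformlySmooth (Icc (0 : Fin s → ℝ) 1)
      fun (_ : ι × Icc (0 : Fin k → ℝ) 1) x j => x j - 1 / 2 :=
    (uniformlySmooth_affine (uniqueDiffOn_cube s) (fun x hx => norm_le_one_of_mem_cube hx)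
      (ContinuousLinearMap.id ℝ _) (c := fun _ _ => -(1 / 2)) (fun _ => le_rfl)).congr
      fun _ x _ => by ext j; simp; ring
  have h₂ := (hF.reindex fun p : ι × Icc (0 : Fin k → ℝ) 1 => p.1).comp h₁ (uniqueDiffOn_cube s)
    (uniqueDiffOn_paramBox s) fun _ => hmaps₁
  have h₃ : UniformlySmooth (Metric.closedBall (0 : EuclideanSpace ℝ (Fin k)) R)
      fun (p : ι × Icc (0 : Fin k → ℝ) 1) m i => dataPoint K p.2.1 i - m i :=
    (uniformlySmooth_affine (uniqueDiffOn_closedBall hR)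
      (fun x hx => mem_closedBall_zero_iff.1 hx)
      (-(EuclideanSpace.equiv (Fin k) ℝ : EuclideanSpace ℝ (Fin k) →L[ℝ] (Fin k → ℝ)))
      (c := fun p => dataPoint K p.2.1) (fun p => norm_dataPoint_le hK.le p.2.2)).congr
      fun p x _ => by ext j; simp [sub_eq_add_neg]
  have h₄ := h₃.comp h₂ (uniqueDiffOn_cube s) (uniqueDiffOn_closedBall hR)
    fun p x hx => mem_closedBall_zero_iff.2 (hFR p.1 _ (hmaps₁ hx))
  have hKR : 0 < K + R := by linarith
  exact (uniformlySmooth_const_of_isCompact (uniqueDiffOn_closedBall hKR)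
    (isCompact_closedBall _ _) (contDiff_gaussianDensity hΓ).contDiffOn).comp h₄
    (uniqueDiffOn_cube s) (uniqueDiffOn_closedBall hKR)
    fun p x hx => norm_misfit_le (norm_dataPoint_le hK.le p.2.2) (hFR p.1 _ (hmaps₁ hx))

/-- `x log x` of averaged likelihoods as a function of the data, uniformly in the averages. -/
theorem uniformlySmooth_mul_log_average_likelihood {k : ℕ} {Γ : Matrix (Fin k) (Fin k) ℝ}
    (hΓ : Γ.PosDef) {K R : ℝ} (hK : 0 < K) (hR : 0 < R) :
    UniformlySmooth (Icc (0 : Fin k → ℝ) 1)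
      fun (a : {n : ℕ // 0 < n} ×
          (ℕ → Metric.closedBall (0 : EuclideanSpace ℝ (Fin k)) R)) t =>
        (∑ i ∈ Finset.Icc 1 a.1.1, (1 / (a.1.1 : ℝ)) • likelihood Γ (a.2 i).1 (dataPoint K t)) *
        Real.log
          (∑ i ∈ Finset.Icc 1 a.1.1, (1 / (a.1.1 : ℝ)) • likelihood Γ (a.2 i).1 (dataPoint K t)) := by
  have hKR : 0 < K + R := by linarith
  obtain ⟨c, C, hc, hcC, hcb⟩ := exists_gaussianDensity_bounds hΓ (K + R)
  have h₁ : UniformlySmooth (Icc (0 : Fin k → ℝ) 1)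
      fun (m : Metric.closedBall (0 : EuclideanSpace ℝ (Fin k)) R) t i =>
        dataPoint K t i - m.1 i :=
    (uniformlySmooth_affine (uniqueDiffOn_cube k) (fun x hx => norm_le_one_of_mem_cube hx)
      ((2 * K) • ContinuousLinearMap.id ℝ (Fin k → ℝ))
      (c := fun (m : Metric.closedBall (0 : EuclideanSpace ℝ (Fin k)) R) i =>
        (fun _ => -K : Fin k → ℝ) i - m.1 i)
      (R := K + R)
      (fun m => mem_closedBall_zero_iff.1 (norm_misfit_le (by
        refine (pi_norm_le_iff_of_nonneg hK.le).2 fun _ => ?_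
        rw [norm_neg, Real.norm_of_nonneg hK.le]) (mem_closedBall_zero_iff.1 m.2)))).congr
      fun p x _ => by ext j; simp [dataPoint]; ring
  have hmaps : ∀ m : Metric.closedBall (0 : EuclideanSpace ℝ (Fin k)) R,
      MapsTo (fun (t : Fin k → ℝ) i => dataPoint K t i - m.1 i) (Icc 0 1)
        (Metric.closedBall (0 : Fin k → ℝ) (K + R)) := fun m t ht =>
    norm_misfit_le (norm_dataPoint_le hK.le ht) (mem_closedBall_zero_iff.1 m.2)
  have h₂ : UniformlySmooth (Icc (0 : Fin k → ℝ) 1)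
      fun (m : Metric.closedBall (0 : EuclideanSpace ℝ (Fin k)) R) t =>
        likelihood Γ m.1 (dataPoint K t) :=
    (uniformlySmooth_const_of_isCompact (uniqueDiffOn_closedBall hKR)
    (isCompact_closedBall _ _) (contDiff_gaussianDensity hΓ).contDiffOn).comp h₁
    (uniqueDiffOn_cube k) (uniqueDiffOn_closedBall hKR) hmaps
  have h₃ := (h₂.average (uniqueDiffOn_cube k)).reindex
    fun a : {n : ℕ // 0 < n} × (ℕ → Metric.closedBall (0 : EuclideanSpace ℝ (Fin k)) R) =>
      (a.1.1, a.2)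
  have hlog : ContDiffOn ℝ ∞ (fun r : ℝ => r * Real.log r) (Icc c C) :=
    contDiffOn_id.mul (contDiffOn_id.log fun r hr => (hc.trans_le hr.1).ne')
  refine (uniformlySmooth_const_of_isCompact (uniqueDiffOn_Icc hcC) isCompact_Icc hlog).comp h₃
    (uniqueDiffOn_cube k) (uniqueDiffOn_Icc hcC) fun a t ht => ?_
  have hn : (0 : ℝ) < a.1.1 := by exact_mod_cast a.1.2
  have hw : ∑ i ∈ Finset.Icc 1 a.1.1, (1 / (a.1.1 : ℝ)) = 1 := by
    rw [Finset.sum_const, Nat.card_Icc, Nat.add_sub_cancel, nsmul_eq_mul]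
    field_simp
  -- A mean of likelihoods stays in `[c, C]`, away from the singularity of the logarithm; this is
  -- where `n > 0` matters.
  exact (convex_Icc c C).sum_mem (fun _ _ => by positivity) hw
    fun i _ => hcb _ (hmaps (a.2 i) ht)

/-! ### Tensor products of two lattice rules -/

theorem latticeRule_mem_Icc {d n : ℕ} (hn : 0 < n) (z : Fin d → ℕ) {f : (Fin d → ℝ) → ℝ} {c C : ℝ}
    (hf : ∀ x ∈ Icc (0 : Fin d → ℝ) 1, f x ∈ Icc c C) (Δ : Fin d → ℝ) :
    latticeRule n z f Δ ∈ Icc c C := by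
  have hn' : (0 : ℝ) < n := by exact_mod_cast hn
  have hw : ∑ i ∈ Finset.Icc 1 n, (1 / (n : ℝ)) = 1 := by
    rw [Finset.sum_const, Nat.card_Icc, Nat.add_sub_cancel, nsmul_eq_mul]
    field_simp
  rw [latticeRule, Finset.mul_sum]
  exact (convex_Icc c C).sum_mem (fun _ _ => by positivity) hw
    fun i _ => hf _ (shiftedPoint_mem n z Δ i)

theorem integral_cube_mem_Icc {d : ℕ} {f : (Fin d → ℝ) → ℝ} {c C : ℝ} (hm : Measurable f)
    (hf : ∀ x ∈ Icc (0 : Fin d → ℝ) 1, f x ∈ Icc c C) : ∫ x, f x ∂cubeMeasure d ∈ Icc c C := by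
  have hb : ∀ᵐ x ∂cubeMeasure d, |f x| ≤ max |c| |C| := (ae_mem_cube d).mono fun x hx =>
    abs_le_max_abs_abs (hf x hx).1 (hf x hx).2
  have hi : Integrable f (cubeMeasure d) := integrable_of_measurable_bound hm hb
  constructor
  · simpa using integral_mono_ae (integrable_const c) hi
      ((ae_mem_cube d).mono fun x hx => (hf x hx).1)
  · simpa using integral_mono_ae hi (integrable_const C)
      ((ae_mem_cube d).mono fun x hx => (hf x hx).2)

theorem measurable_shiftedPoint_pi {d : ℕ} (n : ℕ) (z : Fin d → ℕ) (i : ℕ) :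
    Measurable fun Δ : Fin d → ℝ => shiftedPoint n z Δ i :=
  measurable_pi_iff.2 fun j => measurable_shiftedPoint n z i j

section Tensor

variable {k s n : ℕ} {z₁ : Fin k → ℕ} {z₂ : Fin s → ℕ} {L : (Fin k → ℝ) → (Fin s → ℝ) → ℝ}
  {g : ℝ → ℝ}

/-- The difference between the integral of `g` of the inner integral and the tensor product rule. -/
def tensorError (n : ℕ) (z₁ : Fin k → ℕ) (z₂ : Fin s → ℕ) (L : (Fin k → ℝ) → (Fin s → ℝ) → ℝ)
    (g : ℝ → ℝ) (Δ : (Fin k → ℝ) × (Fin s → ℝ)) : ℝ :=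
  (∫ t, g (∫ x, L t x ∂cubeMeasure s) ∂cubeMeasure k) -
    latticeRule n z₁ (fun t => g (latticeRule n z₂ (L t) Δ.2)) Δ.1

theorem measurable_latticeRule_uncurry (hL : Measurable fun p : (Fin k → ℝ) × (Fin s → ℝ) =>
    L p.1 p.2) :
    Measurable fun p : (Fin k → ℝ) × (Fin s → ℝ) => latticeRule n z₂ (L p.1) p.2 :=
  (Finset.measurable_fun_sum _ fun i _ => hL.comp (measurable_fst.prodMk
    ((measurable_shiftedPoint_pi n z₂ i).comp measurable_snd))).const_mul _

theorem measurable_tensorError (hL : Measurable fun p : (Fin k → ℝ) × (Fin s → ℝ) => L p.1 p.2)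
    (hg : Measurable g) : Measurable (tensorError n z₁ z₂ L g) := by
  refine measurable_const.sub ((Finset.measurable_fun_sum _ fun i _ => hg.comp ?_).const_mul _)
  exact (measurable_latticeRule_uncurry hL).comp
    (((measurable_shiftedPoint_pi n z₁ i).comp measurable_fst).prodMk measurable_snd)

/-- The outer bound is required for every `Δ₂`, since the outer integrand depends on it. The inner
bound is required for every data point, and Fubini in `(t, Δ₂)` averages it. -/
theorem tensorError_sq_le (hn : 0 < n)
    (hL : Measurable fun p : (Fin k → ℝ) × (Fin s → ℝ) => L p.1 p.2)
    (hg : Measurable g) {c C lam A₁ A₂ : ℝ} (hcC : c ≤ C)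
    (hLb : ∀ t ∈ Icc (0 : Fin k → ℝ) 1, ∀ x ∈ Icc (0 : Fin s → ℝ) 1, L t x ∈ Icc c C)
    (h_lip : ∀ a ∈ Icc c C, ∀ b ∈ Icc c C, |g a - g b| ≤ lam * |a - b|)
    (h₁ : ∀ Δ₂, ∫ Δ₁, ((∫ t, g (latticeRule n z₂ (L t) Δ₂) ∂cubeMeasure k) -
      latticeRule n z₁ (fun t => g (latticeRule n z₂ (L t) Δ₂)) Δ₁) ^ 2 ∂cubeMeasure k ≤ A₁)
    (h₂ : ∀ t ∈ Icc (0 : Fin k → ℝ) 1, ∫ Δ₂, ((∫ x, L t x ∂cubeMeasure s) -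
      latticeRule n z₂ (L t) Δ₂) ^ 2 ∂cubeMeasure s ≤ A₂) :
    MemLp (tensorError n z₁ z₂ L g) 2 ((cubeMeasure k).prod (cubeMeasure s)) ∧
    ∫ Δ, tensorError n z₁ z₂ L g Δ ^ 2 ∂(cubeMeasure k).prod (cubeMeasure s) ≤
      2 * (lam ^ 2 * A₂) + 2 * A₁ := by
  set φ : (Fin k → ℝ) → ℝ := fun t => ∫ x, L t x ∂cubeMeasure s with hφ
  have hφm : Measurable φ := (hL.stronglyMeasurable.integral_prod_right
    (ν := cubeMeasure s)).measurable
  have hqm := measurable_latticeRule_uncurry (n := n) (z₂ := z₂) hL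
  have hqm' : ∀ Δ₂, Measurable fun t => latticeRule n z₂ (L t) Δ₂ := fun Δ₂ =>
    hqm.comp measurable_prodMk_right
  have hLm : ∀ t, Measurable (L t) := fun t => Measurable.of_uncurry_left (f := L) hL
  have hφb : ∀ t ∈ Icc (0 : Fin k → ℝ) 1, φ t ∈ Icc c C := fun t ht =>
    integral_cube_mem_Icc (hLm t) (hLb t ht)
  have hqb : ∀ t ∈ Icc (0 : Fin k → ℝ) 1, ∀ Δ₂, latticeRule n z₂ (L t) Δ₂ ∈ Icc c C :=
    fun t ht Δ₂ => latticeRule_mem_Icc hn z₂ (hLb t ht) Δ₂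
  -- The Lipschitz bound from the base point `c` bounds `|g|` on `[c, C]`; all integrability below
  -- rests on it.
  set B := |g c| + |lam| * (C - c) with hB
  have hgB : ∀ a ∈ Icc c C, g a ∈ Icc (-B) B := fun a ha => by
    have h := h_lip a ha c ⟨le_rfl, hcC⟩
    have h3 : lam * |a - c| ≤ |lam| * (C - c) := by
      rw [abs_of_nonneg (sub_nonneg.2 ha.1)]
      exact (mul_le_mul_of_nonneg_right (le_abs_self lam) (sub_nonneg.2 ha.1)).trans
        (mul_le_mul_of_nonneg_left (by linarith [ha.2]) (abs_nonneg _))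
    have h4 : |g a| ≤ |g a - g c| + |g c| := by simpa using abs_add_le (g a - g c) (g c)
    exact abs_le.1 (by linarith)
  have hEm := measurable_tensorError (n := n) (z₁ := z₁) (z₂ := z₂) hL hg
  have hE : ∀ Δ, |tensorError n z₁ z₂ L g Δ| ≤ 2 * B := fun Δ => by
    have e1 := integral_cube_mem_Icc (hg.comp hφm) fun t ht => hgB _ (hφb t ht)
    have e2 := latticeRule_mem_Icc hn z₁ (f := fun t => g (latticeRule n z₂ (L t) Δ.2))
      (fun t ht => hgB _ (hqb t ht Δ.2)) Δ.1
    simp only [Function.comp_apply] at e1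
    rw [tensorError, abs_le]
    constructor <;> linarith [e1.1, e1.2, e2.1, e2.2]
  refine ⟨MemLp.of_bound hEm.aestronglyMeasurable (2 * B) (Filter.Eventually.of_forall hE), ?_⟩
  have hE2 : Integrable (fun Δ => tensorError n z₁ z₂ L g Δ ^ 2)
      ((cubeMeasure k).prod (cubeMeasure s)) := by
    refine integrable_of_measurable_bound (C := (2 * B) ^ 2) (hEm.pow_const 2)
      (Filter.Eventually.of_forall fun Δ => ?_)
    rw [abs_pow]
    exact pow_le_pow_left₀ (abs_nonneg _) (hE Δ) 2
  have hD2 : Integrable (fun p : (Fin k → ℝ) × (Fin s → ℝ) =>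
      (φ p.1 - latticeRule n z₂ (L p.1) p.2) ^ 2) ((cubeMeasure k).prod (cubeMeasure s)) := by
    refine integrable_of_measurable_bound (C := (C - c) ^ 2)
      (((hφm.comp measurable_fst).sub hqm).pow_const 2) ?_
    have : ∀ᵐ p ∂(cubeMeasure k).prod (cubeMeasure s), p.1 ∈ Icc (0 : Fin k → ℝ) 1 :=
      Measure.quasiMeasurePreserving_fst.ae (ae_mem_cube k)
    filter_upwards [this] with p hp
    have e1 := hφb p.1 hp
    have e2 := hqb p.1 hp p.2
    rw [abs_pow]
    refine pow_le_pow_left₀ (abs_nonneg _) ?_ 2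
    rw [abs_le]
    constructor <;> linarith [e1.1, e1.2, e2.1, e2.2]
  have hinner : ∀ Δ₂, ∫ Δ₁, tensorError n z₁ z₂ L g (Δ₁, Δ₂) ^ 2 ∂cubeMeasure k ≤
      2 * (lam ^ 2 * ∫ t, (φ t - latticeRule n z₂ (L t) Δ₂) ^ 2 ∂cubeMeasure k) + 2 * A₁ := by
    intro Δ₂
    set J := ∫ t, g (latticeRule n z₂ (L t) Δ₂) ∂cubeMeasure k with hJ
    set I := ∫ t, g (φ t) ∂cubeMeasure k with hI
    have hgq : Measurable fun t => g (latticeRule n z₂ (L t) Δ₂) := hg.comp (hqm' Δ₂)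
    have hgφ : Measurable fun t => g (φ t) := hg.comp hφm
    have hgqi : Integrable (fun t => g (latticeRule n z₂ (L t) Δ₂)) (cubeMeasure k) :=
      integrable_of_measurable_bound hgq (C := B)
        ((ae_mem_cube k).mono fun t ht => abs_le.2 (hgB _ (hqb t ht Δ₂)))
    have hgφi : Integrable (fun t => g (φ t)) (cubeMeasure k) :=
      integrable_of_measurable_bound hgφ (C := B)
        ((ae_mem_cube k).mono fun t ht => abs_le.2 (hgB _ (hφb t ht)))
    have hd2 : Integrable (fun t => (φ t - latticeRule n z₂ (L t) Δ₂) ^ 2) (cubeMeasure k) := by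
      refine integrable_of_measurable_bound (C := (C - c) ^ 2)
        ((hφm.sub (hqm' Δ₂)).pow_const 2) ((ae_mem_cube k).mono fun t ht => ?_)
      have e1 := hφb t ht
      have e2 := hqb t ht Δ₂
      rw [abs_pow]
      refine pow_le_pow_left₀ (abs_nonneg _) ?_ 2
      rw [abs_le]
      constructor <;> linarith [e1.1, e1.2, e2.1, e2.2]
    have hpt : ∀ᵐ t ∂cubeMeasure k, (g (φ t) - g (latticeRule n z₂ (L t) Δ₂)) ^ 2 ≤
        lam ^ 2 * (φ t - latticeRule n z₂ (L t) Δ₂) ^ 2 := by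
      filter_upwards [ae_mem_cube k] with t ht
      rw [← sq_abs (g _ - _), ← sq_abs (φ t - _), ← mul_pow]
      exact pow_le_pow_left₀ (abs_nonneg _) (h_lip _ (hφb t ht) _ (hqb t ht Δ₂)) 2
    have hIJ : (I - J) ^ 2 ≤
        lam ^ 2 * ∫ t, (φ t - latticeRule n z₂ (L t) Δ₂) ^ 2 ∂cubeMeasure k := by
      have hm2 : Integrable (fun t => (g (φ t) - g (latticeRule n z₂ (L t) Δ₂)) ^ 2)
          (cubeMeasure k) :=
        (hd2.const_mul (lam ^ 2)).mono' ((hgφ.sub hgq).pow_const 2).aestronglyMeasurable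
          (hpt.mono fun t ht => by rwa [Real.norm_of_nonneg (sq_nonneg _)])
      rw [hI, hJ, ← integral_sub hgφi hgqi]
      refine (sq_integral_le (hgφi.sub hgqi) hm2).trans ?_
      rw [← integral_const_mul]
      exact integral_mono_ae hm2 (hd2.const_mul _) hpt
    have hrm : Measurable fun Δ₁ =>
        latticeRule n z₁ (fun t => g (latticeRule n z₂ (L t) Δ₂)) Δ₁ :=
      (Finset.measurable_fun_sum _ fun i _ =>
        hgq.comp (measurable_shiftedPoint_pi n z₁ i)).const_mul _
    have hri : Integrable (fun Δ₁ =>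
        (J - latticeRule n z₁ (fun t => g (latticeRule n z₂ (L t) Δ₂)) Δ₁) ^ 2)
        (cubeMeasure k) := by
      refine integrable_of_measurable_bound (C := (2 * B) ^ 2)
        ((measurable_const.sub hrm).pow_const 2) (Filter.Eventually.of_forall fun Δ₁ => ?_)
      have e1 := integral_cube_mem_Icc hgq fun t ht => hgB _ (hqb t ht Δ₂)
      have e2 := latticeRule_mem_Icc hn z₁ (f := fun t => g (latticeRule n z₂ (L t) Δ₂))
        (fun t ht => hgB _ (hqb t ht Δ₂)) Δ₁
      rw [abs_pow]
      refine pow_le_pow_left₀ (abs_nonneg _) ?_ 2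
      rw [abs_le]
      constructor <;> linarith [e1.1, e1.2, e2.1, e2.2]
    refine (integral_mono_of_nonneg (Filter.Eventually.of_forall fun _ => sq_nonneg _)
      ((integrable_const (2 * (I - J) ^ 2)).add (hri.const_mul 2))
      (Filter.Eventually.of_forall fun Δ₁ => ?_)).trans ?_
    · simp only [tensorError, Pi.add_apply]
      -- This is `(a + b)² ≤ 2a² + 2b²` for `a = I - J` and `b` the outer rule error.
      nlinarith [sq_nonneg ((I - J) - (J - latticeRule n z₁
        (fun t => g (latticeRule n z₂ (L t) Δ₂)) Δ₁))]
    · simp only [Pi.add_apply]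
      rw [integral_add (integrable_const _) (hri.const_mul 2)]
      simp only [integral_const_mul, integral_const, probReal_univ, one_smul]
      linarith [h₁ Δ₂]
  rw [integral_prod_symm _ hE2]
  have hout : Integrable (fun Δ₂ => 2 * (lam ^ 2 * ∫ t, (φ t - latticeRule n z₂ (L t) Δ₂) ^ 2
      ∂cubeMeasure k) + 2 * A₁) (cubeMeasure s) :=
    ((hD2.integral_prod_right.const_mul _).const_mul _).add (integrable_const _)
  refine (integral_mono hE2.integral_prod_right hout hinner).trans ?_
  rw [integral_add ((hD2.integral_prod_right.const_mul _).const_mul _) (integrable_const _),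
    integral_const_mul, integral_const_mul]
  simp only [integral_const, probReal_univ, one_smul]
  have hswap : ∫ Δ₂, ∫ t, (φ t - latticeRule n z₂ (L t) Δ₂) ^ 2 ∂cubeMeasure k ∂cubeMeasure s ≤
      A₂ := by
    rw [← integral_prod_symm _ hD2, integral_prod _ hD2]
    refine (integral_mono_ae hD2.integral_prod_left (integrable_const A₂)
      ((ae_mem_cube k).mono fun t ht => h₂ t ht)).trans ?_
    simp
  have := mul_le_mul_of_nonneg_left hswap (sq_nonneg lam)
  linarith

end Tensor

/-! ### Reduction to the unit cubes -/

/-- The substitution `y = 2 a t - a`. It serves both boxes: `a = 1 / 2` for the parameters, where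
the Jacobian is 1, and `a = K` for the data. -/
theorem setIntegral_symmetric_box {d : ℕ} {a : ℝ} (ha : 0 < a) (f : (Fin d → ℝ) → ℝ) :
    ∫ y in Icc (fun _ => -a) (fun _ => a), f y =
      (2 * a) ^ d * ∫ t, f (dataPoint a t) ∂cubeMeasure d := by
  set H : (Fin d → ℝ) → ℝ := (Icc (fun _ => -a) (fun _ => a)).indicator f with hH
  have hmem : ∀ t : Fin d → ℝ, dataPoint a t ∈ Icc (fun _ => -a) (fun _ => a) ↔
      t ∈ Icc (0 : Fin d → ℝ) 1 := by
    intro t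
    simp only [mem_Icc, Pi.le_def, dataPoint, Pi.zero_apply, Pi.one_apply]
    refine and_congr (forall_congr' fun i => ⟨fun h => ?_, fun h => ?_⟩)
      (forall_congr' fun i => ⟨fun h => ?_, fun h => ?_⟩) <;> nlinarith
  have h1 : ∀ t, (Icc (0 : Fin d → ℝ) 1).indicator (fun t => f (dataPoint a t)) t =
      H ((2 * a) • t - fun _ => a) := by
    intro t
    change _ = H (dataPoint a t)
    by_cases ht : t ∈ Icc (0 : Fin d → ℝ) 1
    · rw [indicator_of_mem ht, hH, indicator_of_mem ((hmem t).2 ht)]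
    · rw [indicator_of_notMem ht, hH, indicator_of_notMem (mt (hmem t).1 ht)]
  rw [← volume_restrict_Icc_eq_cubeMeasure, ← integral_indicator measurableSet_Icc,
    ← integral_indicator measurableSet_Icc]
  simp only [h1]
  rw [Measure.integral_comp_smul volume (fun t => H (t - fun _ => a)) (2 * a),
    integral_sub_right_eq_self, Module.finrank_fin_fun, abs_of_pos (by positivity), smul_eq_mul,
    mul_inv_cancel_left₀ (by positivity)]

theorem truncatedIntegral_eq {s k : ℕ} (Γ : Matrix (Fin k) (Fin k) ℝ)
    (F : (Fin s → ℝ) → EuclideanSpace ℝ (Fin k)) {K : ℝ} (hK : 0 < K) :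
    truncatedIntegral Γ F K = (2 * K) ^ k *
      ∫ t, (fun r => r * Real.log r) (∫ x, likelihood Γ (F fun j => x j - 1 / 2) (dataPoint K t)
        ∂cubeMeasure s) ∂cubeMeasure k := by
  have h : ∀ y, ∫ θ in paramBox s, likelihood Γ (F θ) y =
      ∫ x, likelihood Γ (F fun j => x j - 1 / 2) y ∂cubeMeasure s := by
    intro y
    rw [paramBox, setIntegral_symmetric_box (by norm_num)]
    have e : ∀ t : Fin s → ℝ, dataPoint (1 / 2) t = fun j => t j - 1 / 2 := fun t => by
      ext j
      rw [dataPoint]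
      ring
    simp only [e, mul_one_div_cancel (two_ne_zero' ℝ), one_pow, one_mul]
  rw [truncatedIntegral, dataBox, setIntegral_symmetric_box hK]
  simp only [h, mul_comm (Real.log _)]

theorem fullTensorError_eq {s k : ℕ} (Γ : Matrix (Fin k) (Fin k) ℝ)
    (F : (Fin s → ℝ) → EuclideanSpace ℝ (Fin k)) {K : ℝ} (hK : 0 < K) (n : ℕ)
    (z₁ : Fin k → ℕ) (z₂ : Fin s → ℕ) (Δ : (Fin k → ℝ) × (Fin s → ℝ)) :
    fullTensorError Γ F K n n z₁ z₂ Δ = (2 * K) ^ k *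
      tensorError n z₁ z₂ (fun t x => likelihood Γ (F fun j => x j - 1 / 2) (dataPoint K t))
        (fun r => r * Real.log r) Δ := by
  rw [fullTensorError, truncatedIntegral_eq Γ F hK, tensorError, mul_sub]
  rfl

theorem shiftedPoint_sub_half_mem {d : ℕ} (n : ℕ) (z : Fin d → ℕ) (Δ : Fin d → ℝ) (i : ℕ) :
    (fun j => shiftedPoint n z Δ i j - 1 / 2) ∈ paramBox d :=
  mem_paramBox_of_mem_cube (shiftedPoint_mem n z Δ i)

theorem fullTensorError_congr {s k : ℕ} (Γ : Matrix (Fin k) (Fin k) ℝ)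
    {F F' : (Fin s → ℝ) → EuclideanSpace ℝ (Fin k)} (h : EqOn F F' (paramBox s)) (K : ℝ)
    (n₁ n₂ : ℕ) (z₁ : Fin k → ℕ) (z₂ : Fin s → ℕ) :
    fullTensorError Γ F K n₁ n₂ z₁ z₂ = fullTensorError Γ F' K n₁ n₂ z₁ z₂ := by
  have h1 : ∀ y, ∫ θ in paramBox s, likelihood Γ (F θ) y =
      ∫ θ in paramBox s, likelihood Γ (F' θ) y := fun y =>
    setIntegral_congr_fun measurableSet_Icc fun θ hθ => by simp only [h hθ]
  have h2 : ∀ (Δ : Fin s → ℝ) y, innerRule n₂ z₂ Δ (fun θ => likelihood Γ (F θ) y) =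
      innerRule n₂ z₂ Δ (fun θ => likelihood Γ (F' θ) y) := by
    intro Δ y
    simp only [innerRule, h (shiftedPoint_sub_half_mem n₂ z₂ Δ _)]
  ext Δ
  simp only [fullTensorError, truncatedIntegral, fullTensorApprox, h1, h2]

theorem exists_lipschitz_mul_log {c C : ℝ} (hc : 0 < c) :
    ∃ lam : ℝ, ∀ a ∈ Icc c C, ∀ b ∈ Icc c C,
      |a * Real.log a - b * Real.log b| ≤ lam * |a - b| := by
  obtain ⟨lam, h_lam⟩ := (isCompact_Icc (a := c) (b := C)).exists_bound_of_continuousOn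
    (f := fun x => Real.log x + 1)
    ((Real.continuousOn_log.mono fun x hx => (hc.trans_le hx.1).ne').add continuousOn_const)
  exact ⟨lam, fun a ha b hb => (convex_Icc c C).norm_image_sub_le_of_norm_hasDerivWithin_le
    (f := fun x => x * Real.log x)
    (fun x hx => (Real.hasDerivAt_mul_log (hc.trans_le hx.1).ne').hasDerivWithinAt)
    (fun x hx => h_lam x hx) hb ha⟩

theorem shiftLaw_eq (k s : ℕ) : shiftLaw k s = (cubeMeasure k).prod (cubeMeasure s) := by
  rw [shiftLaw, volume_restrict_Icc_eq_cubeMeasure, volume_restrict_Icc_eq_cubeMeasure]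

theorem measurable_likelihood {k : ℕ} {Γ : Matrix (Fin k) (Fin k) ℝ} (hΓ : Γ.PosDef) :
    Measurable fun p : EuclideanSpace ℝ (Fin k) × (Fin k → ℝ) => likelihood Γ p.1 p.2 := by
  have : Continuous fun (p : EuclideanSpace ℝ (Fin k) × (Fin k → ℝ)) i => p.2 i - p.1 i := by
    fun_prop
  exact ((contDiff_gaussianDensity hΓ).continuous.comp this).measurable

theorem measurable_likelihood_model {k s : ℕ} {Γ : Matrix (Fin k) (Fin k) ℝ} (hΓ : Γ.PosDef)
    {F : (Fin s → ℝ) → EuclideanSpace ℝ (Fin k)} (hF : Measurable F) (K : ℝ) :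
    Measurable fun p : (Fin k → ℝ) × (Fin s → ℝ) =>
      likelihood Γ (F fun j => p.2 j - 1 / 2) (dataPoint K p.1) := by
  have e1 : Measurable fun (p : (Fin k → ℝ) × (Fin s → ℝ)) j => p.2 j - 1 / 2 := by fun_prop
  have e2 : Measurable fun (p : (Fin k → ℝ) × (Fin s → ℝ)) => dataPoint K p.1 := by
    unfold dataPoint
    fun_prop
  have e3 : Measurable fun (p : (Fin k → ℝ) × (Fin s → ℝ)) =>
      ((F fun j => p.2 j - 1 / 2), dataPoint K p.1) := (hF.comp e1).prodMk e2
  have h := (measurable_likelihood hΓ).comp e3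
  exact h

theorem exists_fullTensorError_sq_le {k s : ℕ} {ι : Type*} {Γ : Matrix (Fin k) (Fin k) ℝ}
    (hΓ : Γ.PosDef) {K : ℝ} (hK : 0 < K) {F : ι → (Fin s → ℝ) → EuclideanSpace ℝ (Fin k)}
    (hF : UniformlySmooth (paramBox s) F) (hFm : ∀ a, Measurable (F a))
    {γ₁ : Finset (Fin k) → ℝ} (hγ₁ : ∀ u, 0 < γ₁ u)
    {γ₂ : Finset (Fin s) → ℝ} (hγ₂ : ∀ u, 0 < γ₂ u) :
    ∃ A : ℝ, 0 ≤ A ∧ ∀ (a : ι) (ℓ : ℕ) (z₁ : Fin k → ℕ) (z₂ : Fin s → ℕ),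
      IsCBCVector (2 ^ ℓ) γ₁ z₁ → IsCBCVector (2 ^ ℓ) γ₂ z₂ →
      MemLp (fullTensorError Γ (F a) K (2 ^ ℓ) (2 ^ ℓ) z₁ z₂) 2 (shiftLaw k s) ∧
      ∫ Δ, |fullTensorError Γ (F a) K (2 ^ ℓ) (2 ^ ℓ) z₁ z₂ Δ| ^ 2 ∂shiftLaw k s ≤ A / 2 ^ ℓ := by
  obtain ⟨R, hR1, hR⟩ := hF.exists_bound 0
  have hR0 : 0 < R := by linarith
  have hFR : ∀ a, ∀ θ ∈ paramBox s, ‖F a θ‖ ≤ R := fun a θ hθ => by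
    have := hR a 0 le_rfl θ hθ
    rwa [norm_iteratedFDerivWithin_zero] at this
  obtain ⟨M₂, hM₂⟩ := (uniformlySmooth_likelihood hΓ hK hR0 hF hFR).exists_boundedDerivs s
  obtain ⟨M₁, hM₁⟩ :=
    (uniformlySmooth_mul_log_average_likelihood hΓ hK hR0).exists_boundedDerivs k
  obtain ⟨C₁, hC₁, h₁⟩ := exists_integral_latticeRule_error_sq_le hγ₁
  obtain ⟨C₂, hC₂, h₂⟩ := exists_integral_latticeRule_error_sq_le hγ₂
  obtain ⟨c, C, hc, hcC, hcb⟩ := exists_gaussianDensity_bounds hΓ (K + R)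
  obtain ⟨lam, h_lam⟩ := exists_lipschitz_mul_log (C := C) hc
  refine ⟨((2 * K) ^ k) ^ 2 * (2 * (lam ^ 2 * (M₂ ^ 2 * C₂)) + 2 * (M₁ ^ 2 * C₁)), by positivity,
    fun a ℓ z₁ z₂ hz₁ hz₂ => ?_⟩
  have hn : 0 < 2 ^ ℓ := by positivity
  let L : (Fin k → ℝ) → (Fin s → ℝ) → ℝ := fun t x =>
    likelihood Γ (F a fun j => x j - 1 / 2) (dataPoint K t)
  have hL := measurable_likelihood_model hΓ (hFm a) K
  have hg : Measurable fun r : ℝ => r * Real.log r := by fun_prop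
  have key := tensorError_sq_le (z₁ := z₁) (z₂ := z₂) (L := L) hn hL hg hcC.le (lam := lam)
    (A₁ := M₁ ^ 2 * (C₁ / 2 ^ ℓ)) (A₂ := M₂ ^ 2 * (C₂ / 2 ^ ℓ))
    (fun t ht x hx => hcb _ (norm_misfit_le (norm_dataPoint_le hK.le ht) (hFR a _ (mem_paramBox_of_mem_cube hx))))
    h_lam
    (fun Δ₂ => by
      refine h₁ ℓ z₁ hz₁ M₁ _ ?_
      -- The inner rule is the member of the averaged family given by the model outputs at the
      -- shifted points.
      have h := hM₁ (⟨2 ^ ℓ, hn⟩, fun i => ⟨F a fun j => shiftedPoint (2 ^ ℓ) z₂ Δ₂ i j - 1 / 2,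
        mem_closedBall_zero_iff.2 (hFR a _ (shiftedPoint_sub_half_mem _ z₂ Δ₂ i))⟩)
      simp only [smul_eq_mul, ← Finset.mul_sum] at h
      exact h)
    (fun t ht => h₂ ℓ z₂ hz₂ M₂ _ (hM₂ (a, ⟨t, ht⟩)))
  have heq : fullTensorError Γ (F a) K (2 ^ ℓ) (2 ^ ℓ) z₁ z₂ = fun Δ =>
      (2 * K) ^ k * tensorError (2 ^ ℓ) z₁ z₂ L (fun r => r * Real.log r) Δ :=
    funext fun Δ => fullTensorError_eq Γ (F a) hK (2 ^ ℓ) z₁ z₂ Δ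
  rw [shiftLaw_eq, heq]
  refine ⟨key.1.const_mul _, ?_⟩
  simp only [sq_abs, mul_pow _ (tensorError _ _ _ _ _ _)]
  rw [integral_const_mul]
  refine (mul_le_mul_of_nonneg_left key.2 (by positivity)).trans (le_of_eq ?_)
  ring

end NestedQMC
end

theorem mainTheorem3
    {k : ℕ} {Ξ : Type*}
    (Γ : Matrix (Fin k) (Fin k) ℝ) (hΓ : Γ.PosDef)
    (μmin : ℝ) (hμ0 : 0 < μmin) (hμ1 : μmin ≤ 1)
    (hμ : ∀ μ : ℝ, Module.End.HasEigenvalue (Matrix.toLin' Γ) μ → μmin ≤ μ)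
    (C₀ β p : ℝ) (hC₀ : 1 ≤ C₀) (hβ : 1 ≤ β)
    (hp0 : 0 < p) (hp : p ≤ min (2 / 3) (1 / β)) (hpβ : p ≠ 1 / β)
    (b : ℕ → ℝ) (hb0 : ∀ j, 0 ≤ b j) (hbp : Summable fun j => b j ^ p)
    (G : (s : ℕ) → (Fin s → ℝ) → Ξ → EuclideanSpace ℝ (Fin k))
    (hG : NestedQMC.GevreyRegular C₀ β b G)
    (K : ℝ) (hK : 0 < K)
    (s : ℕ) (hs : 1 ≤ s)
    (γ₁ : Finset (Fin k) → ℝ) (hγ₁ : ∀ u, 0 < γ₁ u)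
    (γ₂ : Finset (Fin s) → ℝ) (hγ₂ : ∀ u, 0 < γ₂ u)
    (δ : ℝ) (hδ : 0 < δ) :
    ∃ C : ℝ, 0 < C ∧
      ∀ (ξ : Ξ) (ℓ : ℕ) (z₁ : Fin k → ℕ) (z₂ : Fin s → ℕ),
        NestedQMC.IsCBCVector (2 ^ ℓ) γ₁ z₁ →
        NestedQMC.IsCBCVector (2 ^ ℓ) γ₂ z₂ →
        MeasureTheory.MemLp
          (NestedQMC.fullTensorError Γ (fun θ => G s θ ξ) K (2 ^ ℓ) (2 ^ ℓ) z₁ z₂) 2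
          (NestedQMC.shiftLaw k s) ∧
        NestedQMC.rms
          (NestedQMC.fullTensorError Γ (fun θ => G s θ ξ) K (2 ^ ℓ) (2 ^ ℓ) z₁ z₂) ≤
          C * ((2 : ℝ) ^ ℓ) ^ (-(1 / 2) + δ) := by
  classical
  have hsm := hG.uniformlySmooth (by linarith) hb0 hs
  -- The model is controlled only on the parameter box. Cutting it off outside makes it measurable
  -- and leaves the error unchanged, as all evaluation points lie in the box.
  let F : Ξ → (Fin s → ℝ) → EuclideanSpace ℝ (Fin k) := fun ξ =>
    (NestedQMC.paramBox s).indicator fun θ => G s θ ξ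
  have hFeq : ∀ ξ, Set.EqOn (F ξ) (fun θ => G s θ ξ) (NestedQMC.paramBox s) := fun ξ θ hθ =>
    Set.indicator_of_mem hθ _
  have hFm : ∀ ξ, Measurable (F ξ) := fun ξ => by
    change Measurable ((NestedQMC.paramBox s).indicator fun θ => G s θ ξ)
    rw [← Set.piecewise_eq_indicator]
    exact (hsm.1 ξ).continuousOn.measurable_piecewise continuousOn_const measurableSet_Icc
  obtain ⟨A, hA, h⟩ := NestedQMC.exists_fullTensorError_sq_le hΓ hK
    (hsm.congr hFeq) hFm hγ₁ hγ₂
  -- The summand 1 only secures positivity of the constant.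
  refine ⟨Real.sqrt A + 1, by positivity, fun ξ ℓ z₁ z₂ hz₁ hz₂ => ?_⟩
  rw [← NestedQMC.fullTensorError_congr Γ (hFeq ξ)]
  obtain ⟨hmem, hle⟩ := h ξ ℓ z₁ z₂ hz₁ hz₂
  refine ⟨hmem, (Real.sqrt_le_sqrt hle).trans ?_⟩
  have h2 : (1 : ℝ) ≤ 2 ^ ℓ := one_le_pow₀ one_le_two
  rw [Real.sqrt_div hA, div_eq_mul_inv, Real.sqrt_eq_rpow (2 ^ ℓ), ← Real.rpow_neg (by positivity)]
  -- As `2 ^ ℓ ≥ 1`, the exponent `-1/2` may be relaxed to `-1/2 + δ`.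
  exact mul_le_mul (by linarith) (Real.rpow_le_rpow_of_exponent_le h2 (by linarith))
    (by positivity) (by positivity)
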